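/- Let $A_0$ be a nonnegative self-adjoint operator in a complex Hilbert space $\mathfrak H$ with inner product $(\cdot,\cdot)$, linear in the first argument. Put $\mathfrak H_1=\mathcal D(A_0^{1/2})=\mathcal D((A_0+I)^{1/2})$, and for $k=1,2$ let $\mathfrak H_{-k}$ be the completion of $\mathfrak H$ in the norm $\|(A_0+I)^{-k/2}u\|$, so that $\mathfrak H\subset\mathfrak H_{-1}\subset\mathfrak H_{-2}$. Let $(\mathbb A_0+I)^{-1}:\mathfrak H_{-2}\to\mathfrak H$ be the extension by continuity of $(A_0+I)^{-1}$, and for $\psi\in\mathfrak H_{-2}$, $u\in\mathcal D(A_0)$ put $\langle\psi,u\rangle=((A_0+I)u,(\mathbb A_0+I)^{-1}\psi)$. Let $\psi_1,\dots,\psi_n\in\mathfrak H_{-2}$ be linearly independent with $\operatorname{span}\{\psi_j\}\cap\mathfrak H=\{0\}$, and put $h_j=(\mathbb A_0+I)^{-1}\psi_j$. Let $A_{\rm sym}$ be the restriction of $A_0$ to $\{u\in\mathcal D(A_0):\langle\psi_j,u\rangle=0,\ 1\le j\le n\}$, a closed densely defined nonnegative symmetric operator, and let $A_F$ be its Friedrichs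 extension. Put $\mathcal H=\ker(A_{\rm sym}^*+I)$, $\mathcal H'=\mathcal H\cap\mathfrak H_1$ and $\mathcal H''=\mathcal H\ominus\mathcal H'$. One has $\mathcal D(A_{\rm sym}^*)=\mathcal D(A_0)\dotplus\mathcal H$, and $h_1,\dots,h_n$ is a basis of $\mathcal H$. For a Hermitian matrix $\mathbf R=(r_{jp})_{j,p=1}^n$ define on $\mathcal D(A_{\rm sym}^*)$ the functionals $$\langle\psi_j^{\rm ex},f\rangle=\langle\psi_j,u\rangle+\sum_{p=1}^n r_{jp}\alpha_p,\qquad f=u+\sum_{p=1}^n\alpha_ph_p,\quad u\in\mathcal D(A_0),\ \alpha_p\in\mathbb C.$$ The matrix $\mathbf R$ is called admissible if, whenever $\psi=\sum_jc_j\psi_j$ belongs to $\mathfrak H_{-1}$, one has, with $h=(\mathbb A_0+I)^{-1}\psi\in\mathfrak H_1$, $$\sum_{j=1}^n\overline{c_j}\,\langle\psi_j^{\rm ex},f\rangle=((A_0+I)^{1/2}f,(A_0+I)^{1/2}h)\qquad\text{for all } f\in\mathcal D(A_{\rm sym}^*)\cap\mathfrak H_1.$$ An operator is called admissible if, for some admissible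 matrix $\mathbf R$, it is the restriction of $A_{\rm sym}^*$ to $\{f\in\mathcal D(A_{\rm sym}^*):\langle\psi_j^{\rm ex},f\rangle=0,\ 1\le j\le n\}$. Theorem. Let $\widetilde A$ be a self-adjoint extension of $A_{\rm sym}$, let $S=\widetilde A\cap A_F$ (the operator whose graph is the intersection of the two graphs), and let $\widetilde{\mathcal H}\subset\mathcal H$ be a subspace such that $S$ is the restriction of $A_F$ to $$\mathcal D(S)=(A_F+I)^{-1}\bigl[\mathcal R(A_{\rm sym}+I)\oplus\widetilde{\mathcal H}\bigr].$$ Then the following are equivalent: (i) $\widetilde A$ is admissible; (ii) $\widetilde A$ is a self-adjoint extension of $S$ that is transversal to the Friedrichs extension $S_F$ of $S$, that is, $\mathcal D(\widetilde A)+\mathcal D(S_F)=\mathcal D(S^*)$, and moreover $\dim\widetilde{\mathcal H}=\dim\mathcal H'$ and $\widetilde{\mathcal H}\cap\mathcal H''=\{0\}$. -/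

import Mathlib

open Filter Topology

noncomputable section

namespace SingularPerturbation

section Operators

variable {H : Type*} [NormedAddCommGroup H] [InnerProductSpace ℂ H]

/-- The linear map `T + I` on the domain of an operator `T`. -/
def addOne (T : H →ₗ.[ℂ] H) : T.domain →ₗ[ℂ] H := T.toFun + T.domain.subtype

/-- The range of `T + I`. -/
def ranAddOne (T : H →ₗ.[ℂ] H) : Submodule ℂ H := LinearMap.range (addOne T)

/-- The null space of `T + I`, as a subspace of the ambient Hilbert space. -/
def kerAddOne (T : H →ₗ.[ℂ] H) : Submodule ℂ H :=
  (LinearMap.ker (addOne T)).map T.domain.subtype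

/-- The inverse image `(T + I)⁻¹ M` of a subspace `M`, as a subspace of the domain of `T`. -/
def preimageAddOne (T : H →ₗ.[ℂ] H) (M : Submodule ℂ H) : Submodule ℂ H :=
  (M.comap (addOne T)).map T.domain.subtype

/-- Nonnegativity of the quadratic form of an operator. -/
def IsNonneg (T : H →ₗ.[ℂ] H) : Prop :=
  ∀ u : T.domain, 0 ≤ (inner ℂ (T u) (u : H)).re

/-- The limits in `H` of sequences in the domain of `T` that are Cauchy
for the quadratic form of `T`. -/
def formLimits (T : H →ₗ.[ℂ] H) : Set H :=
  {f | ∃ u : ℕ → T.domain, Tendsto (fun k => (u k : H)) atTop (𝓝 f) ∧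
    Tendsto (fun p : ℕ × ℕ => (inner ℂ (T (u p.1 - u p.2)) ((u p.1 - u p.2 : T.domain) : H)).re)
      atTop (𝓝 0)}

/-- The domain of the closure of the quadratic form of `T`, that is, the completion of the domain
of `T` for the norm `((T + I) u, u) ^ (1 / 2)`, realized in `H`. For nonnegative `T` the set
`formLimits T` already is a subspace, and the span adds nothing: see `mem_formDomain_iff`. -/
def formDomain (T : H →ₗ.[ℂ] H) : Submodule ℂ H := Submodule.span ℂ (formLimits T)

theorem mem_formDomain_iff {T : H →ₗ.[ℂ] H} (hT : IsNonneg T) (f : H) :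
    f ∈ formDomain T ↔ f ∈ formLimits T := by
  refine ⟨fun hf => ?_, fun hf => Submodule.subset_span hf⟩
  induction hf using Submodule.span_induction with
  | mem x hx => exact hx
  | zero => exact ⟨fun _ => 0, by simp, by simp⟩
  | add x y _ _ hx hy =>
    obtain ⟨u, hu, hu'⟩ := hx
    obtain ⟨v, hv, hv'⟩ := hy
    refine ⟨fun k => u k + v k, by simpa using hu.add hv, ?_⟩
    have hlim := (hu'.const_mul 2).add (hv'.const_mul 2)
    simp only [mul_zero, add_zero] at hlim
    refine squeeze_zero (fun p => hT _) (fun p => ?_) hlim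
    set a := u p.1 - u p.2
    set b := v p.1 - v p.2
    have hab : u p.1 + v p.1 - (u p.2 + v p.2) = a + b := by simp only [a, b]; abel
    rw [hab]
    have h1 := hT (a - b)
    simp only [LinearPMap.map_add, LinearPMap.map_sub, Submodule.coe_add, Submodule.coe_sub,
      inner_add_left, inner_add_right, inner_sub_left, inner_sub_right, Complex.add_re,
      Complex.sub_re] at h1 ⊢
    linarith
  | smul c x _ hx =>
    obtain ⟨u, hu, hu'⟩ := hx
    refine ⟨fun k => c • u k, by simpa using hu.const_smul c, ?_⟩
    have hlim := hu'.const_mul (‖c‖ ^ 2)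
    simp only [mul_zero] at hlim
    refine hlim.congr fun p => ?_
    rw [← smul_sub, LinearPMap.map_smul, Submodule.coe_smul, inner_smul_left, inner_smul_right,
      ← mul_assoc, Complex.conj_mul', ← Complex.ofReal_pow, Complex.re_ofReal_mul]

variable [CompleteSpace H]

/-- The Friedrichs extension of a densely defined nonnegative symmetric operator `T`: the
restriction of the adjoint of `T` to the vectors in the domain of the closed form of `T`. -/
def friedrichs (T : H →ₗ.[ℂ] H) : H →ₗ.[ℂ] H := T.adjoint.domRestrict (formDomain T)

/-- Two extensions `A`, `B` of `S` are transversal: `D(A) + D(B) = D(S*)`. -/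
def Transversal (S A B : H →ₗ.[ℂ] H) : Prop := A.domain ⊔ B.domain = S.adjoint.domain

end Operators

/-- A nonnegative self-adjoint (possibly unbounded) operator in `H`. -/
structure NonnegSelfAdjoint (H : Type*) [NormedAddCommGroup H] [InnerProductSpace ℂ H]
    [CompleteSpace H] where
  toPMap : H →ₗ.[ℂ] H
  isSelfAdjoint : IsSelfAdjoint toPMap
  nonneg : IsNonneg toPMap

/-- A copy of `H` carrying the seminorm `‖T u‖`. -/
def Renormed {H : Type*} [NormedAddCommGroup H] [InnerProductSpace ℂ H] (_T : H →L[ℂ] H) : Type _ :=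
  H

section Renormed

variable {H : Type*} [NormedAddCommGroup H] [InnerProductSpace ℂ H] (T : H →L[ℂ] H)

instance : AddCommGroup (Renormed T) := inferInstanceAs (AddCommGroup H)

instance : Module ℂ (Renormed T) := inferInstanceAs (Module ℂ H)

/-- The identity of `H`, as a map into the renormed copy. -/
def toRenormed : H ≃ₗ[ℂ] Renormed T := LinearEquiv.refl ℂ H

/-- The operator `T` as a linear map on the renormed copy. -/
def renormedMap : Renormed T →ₗ[ℂ] H := T.toLinearMap ∘ₗ (toRenormed T).symm.toLinearMap

instance : SeminormedAddCommGroup (Renormed T) :=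
  SeminormedAddCommGroup.induced (Renormed T) H (renormedMap T)

instance : NormedSpace ℂ (Renormed T) := NormedSpace.induced ℂ (Renormed T) H (renormedMap T)

theorem renormed_norm_def (u : H) : ‖toRenormed T u‖ = ‖T u‖ := rfl

/-- The operator `T`, isometric on the renormed copy. -/
def renormedCLM : Renormed T →L[ℂ] H :=
  (renormedMap T).mkContinuous 1 fun u => by rw [one_mul]; exact le_rfl

/-- The completion of `H` with respect to the norm `‖T u‖`. -/
abbrev NegSpace : Type _ := UniformSpace.Completion (Renormed T)

/-- The canonical map of `H` into its completion with respect to `‖T u‖`. -/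
def toNegSpace : H →ₗ[ℂ] NegSpace T :=
  (UniformSpace.Completion.toComplL (𝕜 := ℂ) (E := Renormed T)).toLinearMap ∘ₗ
    (toRenormed T).toLinearMap

/-- The extension of `T` by continuity to the completion of `H` with respect to `‖T u‖`. -/
def negSpaceExtend [CompleteSpace H] : NegSpace T →L[ℂ] H := (renormedCLM T).fromCompletion

end Renormed

namespace NonnegSelfAdjoint

variable {H : Type*} [NormedAddCommGroup H] [InnerProductSpace ℂ H] [CompleteSpace H]
  (A : NonnegSelfAdjoint H)

theorem norm_le_norm_addOne (u : A.toPMap.domain) : ‖(u : H)‖ ≤ ‖addOne A.toPMap u‖ := by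
  have h1 : ‖(u : H)‖ ^ 2 ≤ (inner ℂ (addOne A.toPMap u) (u : H)).re := by
    have := A.nonneg u
    have h2 : (inner ℂ (u : H) (u : H)).re = ‖(u : H)‖ ^ 2 := by
      rw [inner_self_eq_norm_sq_to_K]; norm_cast
    simp only [addOne, LinearMap.add_apply, inner_add_left, Complex.add_re, Submodule.subtype_apply,
      LinearPMap.toFun_eq_coe]
    linarith
  have h3 : (inner ℂ (addOne A.toPMap u) (u : H)).re ≤ ‖addOne A.toPMap u‖ * ‖(u : H)‖ :=
    (Complex.re_le_norm _).trans (norm_inner_le_norm _ _)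
  by_contra! h
  nlinarith [norm_nonneg (addOne A.toPMap u), norm_nonneg (u : H)]

theorem addOne_injective : Function.Injective (addOne A.toPMap) := by
  rw [injective_iff_map_eq_zero]
  intro u hu
  have := A.norm_le_norm_addOne u
  rw [hu, norm_zero] at this
  exact Subtype.ext (norm_le_zero_iff.mp this)

theorem addOne_surjective : Function.Surjective (addOne A.toPMap) := by
  have hd := A.isSelfAdjoint.dense_domain
  have hclosed : IsClosed (ranAddOne A.toPMap : Set H) := by
    refine isClosed_of_closure_subset fun y hy => ?_
    obtain ⟨v, hv, hvy⟩ := mem_closure_iff_seq_limit.mp hy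
    choose u hu using hv
    have hc : CauchySeq fun k => (u k : H) := by
      rw [Metric.cauchySeq_iff]
      intro ε hε
      obtain ⟨N, hN⟩ := Metric.cauchySeq_iff.mp hvy.cauchySeq ε hε
      refine ⟨N, fun m hm n hn => lt_of_le_of_lt ?_ (hN m hm n hn)⟩
      have := A.norm_le_norm_addOne (u m - u n)
      rw [map_sub, hu, hu] at this
      simpa [dist_eq_norm] using this
    obtain ⟨x, hx⟩ := cauchySeq_tendsto_of_complete hc
    have hA : ∀ k, A.toPMap (u k) = v k - u k := fun k => by
      rw [← hu k]; simp [addOne]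
    have hlim : Tendsto (fun k => ((u k : H), A.toPMap (u k))) atTop (𝓝 (x, y - x)) := by
      simp only [hA]
      exact hx.prodMk_nhds (hvy.sub hx)
    have hmem := A.isSelfAdjoint.isClosed.mem_of_tendsto hlim
      (Eventually.of_forall fun k => A.toPMap.mem_graph (u k))
    obtain ⟨w, hw1, hw2⟩ := (LinearPMap.mem_graph_iff _).mp hmem
    refine ⟨w, ?_⟩
    simp only [addOne, LinearMap.add_apply, Submodule.subtype_apply, LinearPMap.toFun_eq_coe]
    simp only at hw1 hw2
    rw [hw1, hw2, sub_add_cancel]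
  have horth : (ranAddOne A.toPMap)ᗮ = ⊥ := by
    rw [Submodule.eq_bot_iff]
    intro g hg
    have key : ∀ u : A.toPMap.domain, inner ℂ (-g) (u : H) = inner ℂ g (A.toPMap u) := fun u => by
      have := Submodule.inner_left_of_mem_orthogonal (LinearMap.mem_range_self (addOne A.toPMap) u) hg
      simp only [addOne, LinearMap.add_apply, inner_add_right, Submodule.subtype_apply,
        LinearPMap.toFun_eq_coe] at this
      rw [inner_neg_left]
      linear_combination -this
    have hg1 : g ∈ A.toPMap.adjoint.domain :=
      LinearPMap.mem_adjoint_domain_of_exists g ⟨-g, key⟩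
    have hg2 : A.toPMap.adjoint ⟨g, hg1⟩ = -g := LinearPMap.adjoint_apply_eq hd ⟨g, hg1⟩ key
    have hg3 : ((g, -g) : H × H) ∈ A.toPMap.adjoint.graph :=
      (LinearPMap.mem_graph_iff _).mpr ⟨⟨g, hg1⟩, rfl, hg2⟩
    rw [LinearPMap.isSelfAdjoint_def.mp A.isSelfAdjoint] at hg3
    obtain ⟨w, hw1, hw2⟩ := (LinearPMap.mem_graph_iff _).mp hg3
    have := A.norm_le_norm_addOne w
    simp only at hw1 hw2
    simp only [addOne, LinearMap.add_apply, Submodule.subtype_apply, LinearPMap.toFun_eq_coe, hw1,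
      hw2, neg_add_cancel, norm_zero] at this
    exact norm_le_zero_iff.mp this
  have htop : ranAddOne A.toPMap = ⊤ := by
    have : CompleteSpace (ranAddOne A.toPMap) := hclosed.completeSpace_coe
    exact Submodule.orthogonal_eq_bot_iff.mp horth
  exact LinearMap.range_eq_top.mp htop

/-- `A + I` as a bijection of the domain of `A` onto `H`. -/
def addOneEquiv : A.toPMap.domain ≃ₗ[ℂ] H :=
  LinearEquiv.ofBijective (addOne A.toPMap) ⟨A.addOne_injective, A.addOne_surjective⟩

/-- The bounded operator `(A + I)⁻¹` on `H`. -/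
def resolvent : H →L[ℂ] H :=
  (A.toPMap.domain.subtype ∘ₗ A.addOneEquiv.symm.toLinearMap).mkContinuous 1 fun f => by
    have := A.norm_le_norm_addOne (A.addOneEquiv.symm f)
    rw [one_mul]
    refine this.trans (le_of_eq (congrArg norm ?_))
    exact A.addOneEquiv.apply_symm_apply f

theorem resolvent_addOne (u : A.toPMap.domain) : A.resolvent (addOne A.toPMap u) = u :=
  congrArg Subtype.val (A.addOneEquiv.symm_apply_apply u)

theorem resolvent_injective : Function.Injective A.resolvent := by
  intro f g hfg
  exact A.addOneEquiv.symm.injective (Subtype.ext hfg)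

theorem resolvent_nonneg : 0 ≤ A.resolvent := by
  rw [ContinuousLinearMap.nonneg_iff_isPositive, ContinuousLinearMap.isPositive_iff_complex]
  have hd := A.isSelfAdjoint.dense_domain
  have hsym : ∀ u v : A.toPMap.domain,
      inner ℂ (A.toPMap u) (v : H) = inner ℂ (u : H) (A.toPMap v) := by
    have := LinearPMap.adjoint_isFormalAdjoint hd
    rw [LinearPMap.isSelfAdjoint_def.mp A.isSelfAdjoint] at this
    exact this
  intro f
  obtain ⟨u, rfl⟩ := A.addOne_surjective f
  rw [A.resolvent_addOne]
  have hself : inner ℂ (u : H) (addOne A.toPMap u) = inner ℂ (addOne A.toPMap u) (u : H) := by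
    simp only [addOne, LinearMap.add_apply, inner_add_left, inner_add_right,
      Submodule.subtype_apply, LinearPMap.toFun_eq_coe, hsym]
  constructor
  · apply Complex.conj_eq_iff_re.mp
    rw [inner_conj_symm, hself]
  · rw [hself]
    have := A.nonneg u
    simp only [addOne, LinearMap.add_apply, inner_add_left, Submodule.subtype_apply,
      LinearPMap.toFun_eq_coe]
    have h2 : (inner ℂ (u : H) (u : H)).re = ‖(u : H)‖ ^ 2 := by
      rw [inner_self_eq_norm_sq_to_K]; norm_cast
    have h3 := sq_nonneg ‖(u : H)‖
    change 0 ≤ (_ + _ : ℂ).re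
    rw [Complex.add_re, h2]
    linarith

/-- The bounded operator `(A + I)^(-1/2)`, the nonnegative square root of `(A + I)⁻¹`. -/
def sqrtResolvent : H →L[ℂ] H := CFC.sqrt A.resolvent

theorem sqrtResolvent_mul_self : A.sqrtResolvent * A.sqrtResolvent = A.resolvent :=
  CFC.sqrt_mul_sqrt_self A.resolvent A.resolvent_nonneg

theorem sqrtResolvent_injective : Function.Injective A.sqrtResolvent := by
  intro f g hfg
  apply A.resolvent_injective
  rw [← A.sqrtResolvent_mul_self, mul_apply_eq_comp, mul_apply_eq_comp, hfg]

/-- The space `H₁(A) = D(A^(1/2)) = D((A + I)^(1/2))`, the range of `(A + I)^(-1/2)`. -/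
def H1 : Submodule ℂ H := LinearMap.range A.sqrtResolvent.toLinearMap

/-- The operator `(A + I)^(1/2)` with domain `H₁(A)`, the inverse of `(A + I)^(-1/2)`. -/
def sqrtAddOne : A.H1 →ₗ[ℂ] H :=
  (LinearEquiv.ofInjective A.sqrtResolvent.toLinearMap A.sqrtResolvent_injective).symm.toLinearMap

/-- The space `H₋₂(A)`: the completion of `H` in the norm `‖(A + I)⁻¹ u‖`. -/
abbrev HNegTwo : Type _ := NegSpace A.resolvent

/-- The space `H₋₁(A)`: the completion of `H` in the norm `‖(A + I)^(-1/2) u‖`. -/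
abbrev HNegOne : Type _ := NegSpace A.sqrtResolvent

/-- The embedding of `H` into `H₋₂(A)`. -/
def embed : H →ₗ[ℂ] A.HNegTwo := toNegSpace A.resolvent

/-- The identity of `H`, as a continuous map from the `H₋₁`-norm to the `H₋₂`-norm. -/
def idNegOneNegTwo : Renormed A.sqrtResolvent →L[ℂ] Renormed A.resolvent :=
  ((toRenormed A.resolvent).toLinearMap ∘ₗ
    (toRenormed A.sqrtResolvent).symm.toLinearMap).mkContinuous ‖A.sqrtResolvent‖ fun u => by
      change ‖A.resolvent ((toRenormed A.sqrtResolvent).symm u)‖ ≤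
        ‖A.sqrtResolvent‖ * ‖A.sqrtResolvent ((toRenormed A.sqrtResolvent).symm u)‖
      rw [← A.sqrtResolvent_mul_self, mul_apply_eq_comp]
      exact A.sqrtResolvent.le_opNorm _

/-- The embedding of `H₋₁(A)` into `H₋₂(A)`, the extension by continuity of the identity of `H`. -/
def embedNegOne : A.HNegOne →L[ℂ] A.HNegTwo :=
  A.idNegOneNegTwo.completion

/-- The extended resolvent `(𝔸 + I)⁻¹ : H₋₂(A) → H`, the extension by continuity
of `(A + I)⁻¹`. -/
def extResolvent : A.HNegTwo →L[ℂ] H := negSpaceExtend A.resolvent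

theorem extResolvent_embed (f : H) : A.extResolvent (A.embed f) = A.resolvent f :=
  (renormedCLM A.resolvent).fromCompletion_apply_coe (toRenormed A.resolvent f)

/-- The pairing `⟨ψ, u⟩ = ((A + I) u, (𝔸 + I)⁻¹ ψ)` for `ψ ∈ H₋₂(A)` and `u ∈ H₂(A) = D(A)`
(with an inner product that is linear in the first argument). -/
def pairing (ψ : A.HNegTwo) : A.toPMap.domain →ₗ[ℂ] ℂ :=
  (innerₛₗ ℂ (A.extResolvent ψ)) ∘ₗ addOne A.toPMap

variable {n : ℕ} (ψ : Fin n → A.HNegTwo)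

/-- The symmetric operator `A_sym`: the restriction of `A` to the vectors `u ∈ D(A)` with
`⟨ψ_j, u⟩ = 0` for all `j`. -/
def symOp : H →ₗ.[ℂ] H :=
  A.toPMap.domRestrict ((⨅ j, LinearMap.ker (A.pairing (ψ j))).map A.toPMap.domain.subtype)

/-- The defect subspace `ker (A_sym* + I)`. -/
def defect : Submodule ℂ H := kerAddOne (A.symOp ψ).adjoint

/-- The subspace `ker (A_sym* + I) ∩ H₁(A)` of the defect subspace. -/
def defect' : Submodule ℂ H := A.defect ψ ⊓ A.H1

/-- The orthogonal complement of `defect'` in the defect subspace. -/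
def defect'' : Submodule ℂ H := A.defect ψ ⊓ (A.defect' ψ)ᗮ

/-- The operator `S` with domain `(A_F + I)⁻¹ [ran (A_sym + I) ⊕ K]`, a restriction of the
Friedrichs extension `A_F` of `A_sym`. -/
def intermediate (K : Submodule ℂ H) : H →ₗ.[ℂ] H :=
  (friedrichs (A.symOp ψ)).domRestrict
    (preimageAddOne (friedrichs (A.symOp ψ)) (ranAddOne (A.symOp ψ) ⊔ K))

/-- The vectors `h_j = (𝔸 + I)⁻¹ ψ_j`. -/
def defectVec (j : Fin n) : H := A.extResolvent (ψ j)

/-- The linear map sending `(u, α)` to the pair of `f = u + ∑ p, α_p h_p` and the vector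
with entries `⟨ψ_j, u⟩ + ∑ p, r_jp α_p`. -/
def extPairingGraphMap (R : Matrix (Fin n) (Fin n) ℂ) :
    A.toPMap.domain × (Fin n → ℂ) →ₗ[ℂ] H × (Fin n → ℂ) :=
  (A.toPMap.domain.subtype.coprod (Fintype.linearCombination ℂ (A.defectVec ψ))).prod
    ((LinearMap.pi fun j => A.pairing (ψ j)).coprod R.mulVecLin)

theorem extPairingGraphMap_apply (R : Matrix (Fin n) (Fin n) ℂ) (u : A.toPMap.domain)
    (α : Fin n → ℂ) :
    A.extPairingGraphMap ψ R (u, α) =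
      ((u : H) + ∑ p, α p • A.defectVec ψ p,
        fun j => A.pairing (ψ j) u + ∑ p, R j p * α p) := rfl

/-- The vector `(⟨ψ_1^ex, f⟩, …, ⟨ψ_n^ex, f⟩)` of the extended functionals determined by the
matrix `R`: `⟨ψ_j^ex, f⟩ = ⟨ψ_j, u⟩ + ∑ p, r_jp α_p` for `f = u + ∑ p, α_p h_p`, where `u ∈ D(A)`.
It is defined on all `f` of this form, which are the elements of `D(A_sym*)`. -/
def extPairing (R : Matrix (Fin n) (Fin n) ℂ) : H →ₗ.[ℂ] (Fin n → ℂ) :=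
  (LinearMap.range (A.extPairingGraphMap ψ R)).toLinearPMap

/-- A Hermitian matrix `R` is admissible if, for each `χ = ∑ j, c_j ψ_j` in `H₋₁(A)` and each
`f ∈ D(A_sym*) ∩ H₁(A)`, the extended functional `⟨χ^ex, f⟩` is the extension by continuity
`((A + I)^(1/2) f, (A + I)^(1/2) h)` with `h = (𝔸 + I)⁻¹ χ` (an element of `H₁(A)`).
The pairing is conjugate linear in its first slot, hence the conjugates of `c_j`. -/
def IsAdmissibleMatrix (R : Matrix (Fin n) (Fin n) ℂ) : Prop :=
  R.IsHermitian ∧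
    ∀ c : Fin n → ℂ, ∑ j, c j • ψ j ∈ LinearMap.range A.embedNegOne.toLinearMap →
      ∀ (f : (A.extPairing ψ R).domain) (hf : (f : H) ∈ A.H1) (h : A.H1),
        (f : H) ∈ (A.symOp ψ).adjoint.domain →
        (h : H) = A.extResolvent (∑ j, c j • ψ j) →
          ∑ j, starRingEnd ℂ (c j) * A.extPairing ψ R f j =
            inner ℂ (A.sqrtAddOne h) (A.sqrtAddOne ⟨f, hf⟩)

/-- An operator is admissible if it is the restriction of `A_sym*` to the vectors on which all
the extended functionals of some admissible matrix vanish. -/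
def IsAdmissible (B : H →ₗ.[ℂ] H) : Prop :=
  ∃ R : Matrix (Fin n) (Fin n) ℂ, A.IsAdmissibleMatrix ψ R ∧
    B = (A.symOp ψ).adjoint.domRestrict
      ((LinearMap.ker (A.extPairing ψ R).toFun).map (A.extPairing ψ R).domain.subtype)

end NonnegSelfAdjoint

end SingularPerturbation

end

noncomputable section

namespace SingularPerturbation

/-! ### Graphs of restrictions and intersections -/

section Graphs

variable {H E : Type*} [AddCommGroup H] [Module ℂ H] [AddCommGroup E] [Module ℂ E]

/-! Write `B = (A + I)^(-1/2)` and `N = span h_j`. Each `f` in the domain of `A_sym*` is `(A + I)⁻¹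
y + g` with `y = (A_sym* + I) f` and `g ∈ N`, so an extension is encoded by the subspace of its
pairs `(y, g)` (`defectPairs`). In these coordinates `A_sym` is `N^⊥ × 0`, `A_sym*` is `H × N`, and
taking adjoints is the pairing condition `(g', y) = (y', g)`, since the terms with the resolvent
cancel (`mem_defectPairs_adjoint`).

Let `Q = B⁻¹ N` and let `Π` be the projection onto `Q`. The form domain of `A_sym` is `B (Q^⊥)`,
whence `A_F` is the graph `g = -G y` with `G = B Π B` (`mem_graph_friedrichs`). The values of `G`
lie in `𝓗' = B Q` and its kernel is the orthogonal complement of `𝓗'`. Hence the two conditions on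
the subspace `K` of the theorem say exactly that `G` maps `K` bijectively onto `𝓗'`
(`finrank_eq_and_inf_eq_bot_iff`).

A matrix `R` gives the pairs `(y, ∑ α_p h_p)` with `(h_j, y) + (R α)_j = 0`. These reach every `g ∈
N`, and `g = 0` only for `y ∈ N^⊥`. Admissibility of `R` says that the pairs with `g ∈ 𝓗'` lie on `g
= -G y`, so they belong to `S`. This yields the bijectivity of `G` on `K` and, from it,
transversality. Conversely, if `G` is bijective from `K` onto `𝓗'`, self-adjointness makes the pairs
of `Ã` reach all of `N` with `N^⊥` over `g = 0`, and `R` is read off from pairs `(y_p, h_p)`. -/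

theorem mem_graph_domRestrict {T : H →ₗ.[ℂ] E} {M : Submodule ℂ H} {f : H} {w : E} :
    (f, w) ∈ (T.domRestrict M).graph ↔ f ∈ M ∧ (f, w) ∈ T.graph := by
  constructor
  · exact fun h => ⟨(LinearPMap.mem_domain_of_mem_graph h).1,
      LinearPMap.le_graph_of_le LinearPMap.domRestrict_le h⟩
  · rintro ⟨hf, h⟩
    obtain ⟨x, hx, hw⟩ := (LinearPMap.mem_graph_iff _).mp h
    simp only at hx hw
    subst hx
    exact (LinearPMap.mem_graph_iff _).mpr ⟨⟨x, hf, x.2⟩, rfl,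
      ((LinearPMap.domRestrict_le (f := T)).2 rfl).trans hw⟩

theorem mem_graph_inf {T U : H →ₗ.[ℂ] E} {f : H} {w : E} :
    (f, w) ∈ (T ⊓ U).graph ↔ (f, w) ∈ T.graph ∧ (f, w) ∈ U.graph := by
  constructor
  · exact fun h => ⟨LinearPMap.le_graph_of_le inf_le_left h, LinearPMap.le_graph_of_le inf_le_right h⟩
  · rintro ⟨h1, h2⟩
    obtain ⟨x, hx, hw⟩ := (LinearPMap.mem_graph_iff _).mp h1
    obtain ⟨y, hy, hv⟩ := (LinearPMap.mem_graph_iff _).mp h2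
    obtain ⟨x, hxm⟩ := x
    obtain ⟨y, hym⟩ := y
    simp only at hx hw hy hv
    subst hx hy
    exact (LinearPMap.mem_graph_iff _).mpr ⟨⟨y, hxm, hym, hw.trans hv.symm⟩, rfl, hw⟩

theorem eq_of_mem_graph_iff {T U : H →ₗ.[ℂ] E}
    (h : ∀ f w, (f, w) ∈ T.graph ↔ (f, w) ∈ U.graph) : T = U :=
  LinearPMap.eq_of_eq_graph (Submodule.ext fun p => h p.1 p.2)

end Graphs

/-! ### The operator `T + I` in terms of graphs; adjoints and form domains -/

section Operators

variable {H : Type*} [NormedAddCommGroup H] [InnerProductSpace ℂ H]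

/-- Graph points are parametrized by `f` and `y = (T + I) f` throughout; this is the passage to that
form. -/
theorem exists_addOne_iff {T : H →ₗ.[ℂ] H} {f y : H} :
    (∃ u : T.domain, (u : H) = f ∧ addOne T u = y) ↔ (f, y - f) ∈ T.graph := by
  rw [LinearPMap.mem_graph_iff]
  refine exists_congr fun u => and_congr_right fun hu => ?_
  simp only [addOne, LinearMap.add_apply, Submodule.subtype_apply, LinearPMap.toFun_eq_coe,
    hu, eq_sub_iff_add_eq]

theorem mem_ranAddOne_iff {T : H →ₗ.[ℂ] H} {y : H} :
    y ∈ ranAddOne T ↔ ∃ f, (f, y - f) ∈ T.graph := by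
  simp only [← exists_addOne_iff]
  exact ⟨fun ⟨u, hu⟩ => ⟨u, u, rfl, hu⟩, fun ⟨_, u, _, hu⟩ => ⟨u, hu⟩⟩

theorem mem_kerAddOne_iff {T : H →ₗ.[ℂ] H} {f : H} :
    f ∈ kerAddOne T ↔ (f, -f) ∈ T.graph := by
  rw [← zero_sub f, ← exists_addOne_iff]
  exact ⟨fun ⟨u, hu, hf⟩ => ⟨u, hf, hu⟩, fun ⟨u, hu, hf⟩ => ⟨u, hf, hu⟩⟩

theorem mem_preimageAddOne_iff {T : H →ₗ.[ℂ] H} {M : Submodule ℂ H} {f : H} :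
    f ∈ preimageAddOne T M ↔ ∃ y ∈ M, (f, y - f) ∈ T.graph := by
  simp only [← exists_addOne_iff]
  exact ⟨fun ⟨u, hu, hf⟩ => ⟨addOne T u, hu, u, hf, rfl⟩,
    fun ⟨_, hy, u, hf, hu⟩ => ⟨u, by rwa [← hu] at hy, hf⟩⟩

theorem mem_graph_adjoint_iff [CompleteSpace H] {T : H →ₗ.[ℂ] H} (hT : Dense (T.domain : Set H))
    {f w : H} : (f, w) ∈ T.adjoint.graph ↔
      ∀ a b, (a, b) ∈ T.graph → inner ℂ b f = inner ℂ a w := by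
  rw [LinearPMap.adjoint_graph_eq_graph_adjoint hT, Submodule.mem_adjoint_iff]
  simp only [sub_eq_zero]

theorem adjoint_le_adjoint [CompleteSpace H] {T U : H →ₗ.[ℂ] H} (h : T ≤ U)
    (hT : Dense (T.domain : Set H)) : U.adjoint ≤ T.adjoint := by
  have hU : Dense (U.domain : Set H) := hT.mono h.1
  refine LinearPMap.le_of_le_graph fun p hp => ?_
  obtain ⟨f, w⟩ := p
  rw [mem_graph_adjoint_iff hU] at hp
  rw [mem_graph_adjoint_iff hT]
  exact fun a b hab => hp a b (LinearPMap.le_graph_of_le h hab)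

theorem formLimits_mono {T U : H →ₗ.[ℂ] H} (h : T ≤ U) : formLimits T ⊆ formLimits U := by
  rintro f ⟨u, hu, hu'⟩
  refine ⟨fun k => ⟨u k, h.1 (u k).2⟩, hu, hu'.congr fun p => ?_⟩
  rw [h.2 (x := u p.1 - u p.2) (y := ⟨u p.1, h.1 (u p.1).2⟩ - ⟨u p.2, h.1 (u p.2).2⟩) rfl]
  rfl

theorem formDomain_mono {T U : H →ₗ.[ℂ] H} (h : T ≤ U) : formDomain T ≤ formDomain U :=
  Submodule.span_mono (formLimits_mono h)

end Operators

/-! ### The spaces `H₋₁` and `H₋₂` as isometric images in `H` -/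

section NegSpace

variable {H : Type*} [NormedAddCommGroup H] [InnerProductSpace ℂ H] [CompleteSpace H]
  (T : H →L[ℂ] H)

theorem norm_negSpaceExtend (x : NegSpace T) : ‖negSpaceExtend T x‖ = ‖x‖ := by
  induction x using UniformSpace.Completion.induction_on with
  | hp => exact isClosed_eq (negSpaceExtend T).continuous.norm continuous_norm
  | ih a =>
    rw [UniformSpace.Completion.norm_coe]
    exact congrArg norm ((renormedCLM T).fromCompletion_apply_coe a)

theorem negSpaceExtend_injective : Function.Injective (negSpaceExtend T) := by
  refine (injective_iff_map_eq_zero _).mpr fun x hx => ?_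
  rw [← norm_eq_zero, ← norm_negSpaceExtend, hx, norm_zero]

theorem negSpaceExtend_toNegSpace (f : H) : negSpaceExtend T (toNegSpace T f) = T f :=
  (renormedCLM T).fromCompletion_apply_coe (toRenormed T f)

/-- The extension is an isometry on a complete space, so its range is closed, and it contains the
dense range of `T`. -/
theorem negSpaceExtend_surjective (hT : DenseRange T) :
    Function.Surjective (negSpaceExtend T) := by
  have hiso : Isometry (negSpaceExtend T) :=
    AddMonoidHomClass.isometry_of_norm _ (norm_negSpaceExtend T)
  have hcl : IsClosed (Set.range (negSpaceExtend T)) := hiso.isClosedEmbedding.isClosed_range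
  intro y
  have hsub : Set.range T ⊆ Set.range (negSpaceExtend T) := by
    rintro _ ⟨f, rfl⟩
    exact ⟨toNegSpace T f, negSpaceExtend_toNegSpace T f⟩
  exact closure_minimal hsub hcl (hT y)

end NegSpace

/-! ### Resolvent calculus, the span of the `h_j`, and the adjoint of `A_sym` -/

namespace NonnegSelfAdjoint

variable {H : Type*} [NormedAddCommGroup H] [InnerProductSpace ℂ H] [CompleteSpace H]
  (A : NonnegSelfAdjoint H)

theorem inner_sqrtResolvent (f g : H) :
    inner ℂ (A.sqrtResolvent f) g = inner ℂ f (A.sqrtResolvent g) := by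
  have h : IsSelfAdjoint A.sqrtResolvent := (CFC.sqrt_nonneg A.resolvent).isSelfAdjoint
  exact (ContinuousLinearMap.isSelfAdjoint_iff_isSymmetric.mp h) f g

theorem sqrtResolvent_sqrtResolvent (f : H) :
    A.sqrtResolvent (A.sqrtResolvent f) = A.resolvent f := by
  rw [← A.sqrtResolvent_mul_self, mul_apply_eq_comp]

theorem inner_resolvent (f g : H) : inner ℂ (A.resolvent f) g = inner ℂ f (A.resolvent g) := by
  simp only [← sqrtResolvent_sqrtResolvent, inner_sqrtResolvent]

theorem denseRange_sqrtResolvent : DenseRange A.sqrtResolvent := by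
  have h : (LinearMap.range A.sqrtResolvent.toLinearMap)ᗮ = ⊥ := by
    rw [Submodule.eq_bot_iff]
    intro g hg
    apply A.sqrtResolvent_injective
    rw [map_zero, ← inner_self_eq_zero (𝕜 := ℂ), ← A.inner_sqrtResolvent]
    exact hg _ ⟨_, rfl⟩
  rw [← Submodule.topologicalClosure_eq_top_iff, ← Submodule.dense_iff_topologicalClosure_eq_top] at h
  exact h

theorem mem_graph_iff {f y : H} : (f, y - f) ∈ A.toPMap.graph ↔ f = A.resolvent y := by
  rw [← exists_addOne_iff]
  constructor
  · rintro ⟨u, rfl, rfl⟩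
    exact (A.resolvent_addOne u).symm
  · rintro rfl
    obtain ⟨u, rfl⟩ := A.addOne_surjective y
    exact ⟨u, (A.resolvent_addOne u).symm, rfl⟩

theorem extResolvent_injective : Function.Injective A.extResolvent :=
  negSpaceExtend_injective A.resolvent

theorem extResolvent_embedNegOne (χ : A.HNegOne) :
    A.extResolvent (A.embedNegOne χ) = A.sqrtResolvent (negSpaceExtend A.sqrtResolvent χ) := by
  induction χ using UniformSpace.Completion.induction_on with
  | hp => exact isClosed_eq (by fun_prop) (by fun_prop)
  | ih a =>
    have h1 : A.embedNegOne (a : A.HNegOne) = (A.idNegOneNegTwo a : A.HNegTwo) :=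
      ContinuousLinearMap.completion_apply_coe _ _
    rw [h1]
    refine ((renormedCLM A.resolvent).fromCompletion_apply_coe _).trans ?_
    refine Eq.trans ?_ (congrArg A.sqrtResolvent
      ((renormedCLM A.sqrtResolvent).fromCompletion_apply_coe a)).symm
    exact (A.sqrtResolvent_sqrtResolvent ((toRenormed A.sqrtResolvent).symm a)).symm

/-- The extension of `(A + I)^(-1/2)` maps `H₋₁` onto `H`, and the extended resolvent factors
through it on `H₋₁`. Admissibility can thus be tested on vectors of `H₁` without mention of `H₋₁`.
-/
theorem mem_range_embedNegOne {χ : A.HNegTwo} (h : A.extResolvent χ ∈ A.H1) :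
    χ ∈ LinearMap.range A.embedNegOne.toLinearMap := by
  obtain ⟨q, hq⟩ := h
  obtain ⟨ζ, rfl⟩ := negSpaceExtend_surjective _ A.denseRange_sqrtResolvent q
  exact ⟨ζ, A.extResolvent_injective ((A.extResolvent_embedNegOne ζ).trans hq)⟩

theorem sqrtAddOne_eq {f : A.H1} {q : H} (h : A.sqrtResolvent q = f) : A.sqrtAddOne f = q := by
  have : f = LinearEquiv.ofInjective A.sqrtResolvent.toLinearMap A.sqrtResolvent_injective q :=
    Subtype.ext h.symm
  rw [this]
  exact LinearEquiv.symm_apply_apply _ _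

variable {n : ℕ} (ψ : Fin n → A.HNegTwo)

/-- The linear span of the vectors `h_j`. -/
def defectSpan : Submodule ℂ H := Submodule.span ℂ (Set.range (A.defectVec ψ))

instance : FiniteDimensional ℂ (A.defectSpan ψ) :=
  FiniteDimensional.span_of_finite ℂ (Set.finite_range _)

theorem defectVec_mem (j : Fin n) : A.defectVec ψ j ∈ A.defectSpan ψ :=
  Submodule.subset_span ⟨j, rfl⟩

theorem mem_orthogonal_defectSpan {y : H} :
    y ∈ (A.defectSpan ψ)ᗮ ↔ ∀ j, inner ℂ (A.defectVec ψ j) y = 0 := by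
  refine ⟨fun h j => h _ (A.defectVec_mem ψ j), fun h g hg => ?_⟩
  induction hg using Submodule.span_induction with
  | mem x hx => obtain ⟨j, rfl⟩ := hx; exact h j
  | zero => simp
  | add x z _ _ hx hz => rw [inner_add_left, hx, hz, add_zero]
  | smul c x _ hx => rw [inner_smul_left, hx, mul_zero]

theorem mem_defectSpan_iff {g : H} :
    g ∈ A.defectSpan ψ ↔ ∃ α : Fin n → ℂ, ∑ p, α p • A.defectVec ψ p = g := by
  rw [defectSpan, Submodule.mem_span_range_iff_exists_fun]

theorem extResolvent_sum (c : Fin n → ℂ) :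
    A.extResolvent (∑ j, c j • ψ j) = ∑ j, c j • A.defectVec ψ j := by
  simp [defectVec]

theorem linearIndependent_defectVec (hψ : LinearIndependent ℂ ψ) :
    LinearIndependent ℂ (A.defectVec ψ) :=
  hψ.map' A.extResolvent.toLinearMap (LinearMap.ker_eq_bot.mpr A.extResolvent_injective)

/-- Since the extended resolvent is injective, the condition `span ψ_j ∩ H = 0` becomes `D(A) ∩ span
h_j = 0`. This is the hypothesis `hN` of the later lemmas; it gives density of the domain of `A_sym`
and uniqueness of the decomposition `f = u + g`. -/
theorem eq_zero_of_resolvent_mem_defectSpan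
    (hψH : Submodule.span ℂ (Set.range ψ) ⊓ LinearMap.range A.embed = ⊥) (y : H)
    (hy : A.resolvent y ∈ A.defectSpan ψ) : y = 0 := by
  obtain ⟨c, hc⟩ := (A.mem_defectSpan_iff ψ).mp hy
  rw [← extResolvent_sum, ← extResolvent_embed] at hc
  have h := A.extResolvent_injective hc
  have h0 : A.embed y ∈ Submodule.span ℂ (Set.range ψ) ⊓ LinearMap.range A.embed :=
    ⟨h ▸ Submodule.sum_mem _ fun j _ => Submodule.smul_mem _ _ (Submodule.subset_span ⟨j, rfl⟩),
      ⟨y, rfl⟩⟩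
  rw [hψH, Submodule.mem_bot] at h0
  apply A.resolvent_injective
  rw [← extResolvent_embed, h0, map_zero, map_zero]

theorem mem_graph_symOp {f y : H} :
    (f, y - f) ∈ (A.symOp ψ).graph ↔ f = A.resolvent y ∧ y ∈ (A.defectSpan ψ)ᗮ := by
  rw [symOp, mem_graph_domRestrict, mem_graph_iff, and_comm]
  refine and_congr_right fun hf => ?_
  subst hf
  obtain ⟨u, rfl⟩ := A.addOne_surjective y
  rw [mem_orthogonal_defectSpan, A.resolvent_addOne]
  constructor
  · rintro ⟨v, hv, hvu⟩ j
    rw [← Subtype.ext hvu]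
    exact (Submodule.mem_iInf _).mp hv j
  · exact fun h => ⟨u, (Submodule.mem_iInf _).mpr h, rfl⟩

theorem mem_domain_symOp {f : H} :
    f ∈ (A.symOp ψ).domain ↔ ∃ y ∈ (A.defectSpan ψ)ᗮ, f = A.resolvent y := by
  rw [LinearPMap.mem_domain_iff]
  constructor
  · rintro ⟨w, hw⟩
    rw [← add_sub_cancel_right w f, mem_graph_symOp] at hw
    exact ⟨_, hw.2, hw.1⟩
  · rintro ⟨y, hy, hf⟩
    exact ⟨y - f, (A.mem_graph_symOp ψ).mpr ⟨hf, hy⟩⟩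

theorem ranAddOne_symOp : ranAddOne (A.symOp ψ) = (A.defectSpan ψ)ᗮ := by
  ext y
  simp only [mem_ranAddOne_iff, mem_graph_symOp]
  exact ⟨fun ⟨_, _, h⟩ => h, fun h => ⟨_, rfl, h⟩⟩

theorem isNonneg_symOp : IsNonneg (A.symOp ψ) := fun u => A.nonneg ⟨u, u.2.2⟩

variable {ψ}

/-- If `g` is orthogonal to `(A + I)⁻¹ N^⊥`, then `(A + I)⁻¹ g` lies in `N^⊥⊥ = N`, as `N` has
finite dimension. -/
theorem dense_domain_symOp (hN : ∀ y, A.resolvent y ∈ A.defectSpan ψ → y = 0) :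
    Dense ((A.symOp ψ).domain : Set H) := by
  rw [Submodule.dense_iff_topologicalClosure_eq_top, Submodule.topologicalClosure_eq_top_iff,
    Submodule.eq_bot_iff]
  intro g hg
  refine hN g ?_
  rw [← Submodule.orthogonal_orthogonal (A.defectSpan ψ)]
  intro m hm
  rw [← inner_resolvent]
  exact hg _ ((A.mem_domain_symOp ψ).mpr ⟨m, hm, rfl⟩)

/-- Tested against `(A + I)⁻¹ m` with `m ∈ N^⊥`, the adjoint relation reads `(m, f - (A + I)⁻¹ y) =
0`, and `N^⊥⊥ = N`. -/
theorem mem_graph_adjoint_symOp (hN : ∀ y, A.resolvent y ∈ A.defectSpan ψ → y = 0) {f y : H} :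
    (f, y - f) ∈ (A.symOp ψ).adjoint.graph ↔ f - A.resolvent y ∈ A.defectSpan ψ := by
  rw [mem_graph_adjoint_iff (A.dense_domain_symOp hN),
    ← Submodule.orthogonal_orthogonal (A.defectSpan ψ)]
  constructor
  · intro h m hm
    have := h _ _ ((A.mem_graph_symOp ψ).mpr ⟨rfl, hm⟩)
    rw [inner_sub_left, inner_sub_right, inner_resolvent A m y] at this
    rw [inner_sub_right]
    linear_combination this
  · intro h a b hab
    rw [← add_sub_cancel_right b a, mem_graph_symOp] at hab
    have := h _ hab.2
    rw [inner_sub_right, ← inner_resolvent, ← hab.1, inner_add_left] at this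
    rw [inner_sub_right]
    linear_combination this

theorem defect_eq (hN : ∀ y, A.resolvent y ∈ A.defectSpan ψ → y = 0) :
    A.defect ψ = A.defectSpan ψ := by
  ext f
  rw [defect, mem_kerAddOne_iff, ← zero_sub, A.mem_graph_adjoint_symOp hN, map_zero, sub_zero]

end NonnegSelfAdjoint
end SingularPerturbation

/-! ### The Friedrichs extension of `A_sym`, admissible functionals -/

namespace SingularPerturbation
namespace NonnegSelfAdjoint

variable {H : Type*} [NormedAddCommGroup H] [InnerProductSpace ℂ H] [CompleteSpace H]
  (A : NonnegSelfAdjoint H) {n : ℕ} (ψ : Fin n → A.HNegTwo)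

/-- The inverse image of the span of the `h_j` under `(A + I)^(-1/2)`. -/
def sqrtDefect : Submodule ℂ H := (A.defectSpan ψ).comap A.sqrtResolvent.toLinearMap

theorem mem_sqrtDefect {q : H} : q ∈ A.sqrtDefect ψ ↔ A.sqrtResolvent q ∈ A.defectSpan ψ := Iff.rfl

instance : FiniteDimensional ℂ (A.sqrtDefect ψ) := by
  refine FiniteDimensional.of_injective
    (A.sqrtResolvent.toLinearMap.restrict (p := A.sqrtDefect ψ) (q := A.defectSpan ψ)
      fun _ h => h) fun x y h => ?_
  exact Subtype.ext (A.sqrtResolvent_injective (congrArg Subtype.val h))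

theorem orthogonal_map_sqrtResolvent :
    ((A.defectSpan ψ)ᗮ.map A.sqrtResolvent.toLinearMap)ᗮ = A.sqrtDefect ψ := by
  ext q
  have hq : q ∈ A.sqrtDefect ψ ↔ A.sqrtResolvent q ∈ (A.defectSpan ψ)ᗮᗮ := by
    rw [Submodule.orthogonal_orthogonal, mem_sqrtDefect]
  rw [hq]
  constructor
  · intro h m hm
    rw [← inner_sqrtResolvent]
    exact h _ ⟨m, hm, rfl⟩
  · rintro h _ ⟨m, hm, rfl⟩
    exact (A.inner_sqrtResolvent m q).trans (h m hm)

theorem orthogonal_sqrtDefect :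
    (A.sqrtDefect ψ)ᗮ =
      ((A.defectSpan ψ)ᗮ.map A.sqrtResolvent.toLinearMap).topologicalClosure := by
  rw [← orthogonal_map_sqrtResolvent, Submodule.orthogonal_orthogonal_eq_closure]

theorem sqrtResolvent_mem_orthogonal_sqrtDefect {y : H} :
    A.sqrtResolvent y ∈ (A.sqrtDefect ψ)ᗮ ↔ y ∈ ((A.sqrtDefect ψ).map A.sqrtResolvent.toLinearMap)ᗮ := by
  constructor
  · rintro h _ ⟨q, hq, rfl⟩
    exact (A.inner_sqrtResolvent q y).trans (h q hq)
  · intro h q hq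
    rw [← inner_sqrtResolvent]
    exact h _ ⟨q, hq, rfl⟩

theorem addOne_symOp (v : (A.symOp ψ).domain) :
    (v : H) = A.resolvent (addOne (A.symOp ψ) v) ∧
      addOne (A.symOp ψ) v ∈ (A.defectSpan ψ)ᗮ :=
  (A.mem_graph_symOp ψ).mp (exists_addOne_iff.mp ⟨v, rfl, rfl⟩)

theorem re_inner_symOp (v : (A.symOp ψ).domain) :
    (inner ℂ (A.symOp ψ v) (v : H)).re =
      ‖A.sqrtResolvent (addOne (A.symOp ψ) v)‖ ^ 2 - ‖(v : H)‖ ^ 2 := by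
  have h1 : A.symOp ψ v = addOne (A.symOp ψ) v - v := by simp [addOne]
  have h2 : inner ℂ (addOne (A.symOp ψ) v) (v : H) =
      inner ℂ (A.sqrtResolvent (addOne (A.symOp ψ) v)) (A.sqrtResolvent (addOne (A.symOp ψ) v)) := by
    rw [inner_sqrtResolvent, sqrtResolvent_sqrtResolvent, ← (A.addOne_symOp ψ v).1]
  rw [h1, inner_sub_left, h2, inner_self_eq_norm_sq_to_K, inner_self_eq_norm_sq_to_K]
  norm_cast

/-- For `v = (A + I)⁻¹ y` the form of `A_sym + I` equals `‖B y‖²` with `B = (A + I)^(-1/2)`, and `v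
= B (B y)`. Completing in the form norm therefore means closing `B (N^⊥)`, whose closure is `Q^⊥`,
and applying `B`. -/
theorem mem_formDomain_symOp {f : H} :
    f ∈ formDomain (A.symOp ψ) ↔ ∃ q ∈ (A.sqrtDefect ψ)ᗮ, A.sqrtResolvent q = f := by
  constructor
  · intro hf
    obtain ⟨u, hu, hu'⟩ := (mem_formDomain_iff (A.isNonneg_symOp ψ) f).mp hf
    have hd : Tendsto (fun p : ℕ × ℕ => ‖((u p.1 - u p.2 : (A.symOp ψ).domain) : H)‖ ^ 2)
        atTop (𝓝 0) := by
      have h := ((cauchySeq_iff_tendsto_dist_atTop_0.mp hu.cauchySeq).pow 2)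
      simpa [dist_eq_norm] using h
    -- Adding `‖u_p - u_q‖²` turns the form of `A_sym` into that of `A_sym + I`, a squared norm.
    have hs := hu'.add hd
    simp only [re_inner_symOp, sub_add_cancel, add_zero] at hs
    have hc : CauchySeq fun k => A.sqrtResolvent (addOne (A.symOp ψ) (u k)) := by
      rw [cauchySeq_iff_tendsto_dist_atTop_0]
      have h := hs.sqrt
      simpa [dist_eq_norm, Real.sqrt_sq (norm_nonneg _)] using h
    obtain ⟨q, hq⟩ := cauchySeq_tendsto_of_complete hc
    refine ⟨q, ?_, ?_⟩
    · refine (Submodule.isClosed_orthogonal _).mem_of_tendsto hq (Eventually.of_forall fun k => ?_)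
      rw [orthogonal_sqrtDefect]
      exact Submodule.le_topologicalClosure _ ⟨_, (A.addOne_symOp ψ (u k)).2, rfl⟩
    · refine tendsto_nhds_unique ((A.sqrtResolvent.continuous.tendsto q).comp hq) (hu.congr fun k => ?_)
      rw [Function.comp_apply, sqrtResolvent_sqrtResolvent, ← (A.addOne_symOp ψ (u k)).1]
  · rintro ⟨q, hq, rfl⟩
    rw [orthogonal_sqrtDefect] at hq
    obtain ⟨x, hx, hxq⟩ := mem_closure_iff_seq_limit.mp hq
    choose y hy hyx using hx
    have hmem : ∀ k, A.resolvent (y k) ∈ (A.symOp ψ).domain := fun k =>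
      (A.mem_domain_symOp ψ).mpr ⟨y k, hy k, rfl⟩
    have haddOne : ∀ k, addOne (A.symOp ψ) ⟨_, hmem k⟩ = y k := fun k =>
      A.resolvent_injective (A.addOne_symOp ψ ⟨_, hmem k⟩).1.symm
    have hlim : Tendsto (fun k => A.resolvent (y k)) atTop (𝓝 (A.sqrtResolvent q)) := by
      refine ((A.sqrtResolvent.continuous.tendsto q).comp hxq).congr fun k => ?_
      rw [Function.comp_apply, ← hyx, ← sqrtResolvent_sqrtResolvent]
      rfl
    refine Submodule.subset_span ⟨fun k => ⟨_, hmem k⟩, hlim, ?_⟩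
    have h1 := (cauchySeq_iff_tendsto_dist_atTop_0.mp hlim.cauchySeq).pow 2
    have h2 := (cauchySeq_iff_tendsto_dist_atTop_0.mp hxq.cauchySeq).pow 2
    have h3 := h2.sub h1
    rw [sub_self] at h3
    refine h3.congr fun p => ?_
    rw [re_inner_symOp, map_sub, haddOne, haddOne, map_sub, dist_eq_norm, dist_eq_norm,
      ← hyx, ← hyx]
    rfl

/-- The difference of `(A + I)⁻¹` and `(A_F + I)⁻¹`, where `A_F` is the Friedrichs extension
of `A_sym`. -/
def friedrichsShift : H →L[ℂ] H :=
  A.sqrtResolvent ∘L (A.sqrtDefect ψ).starProjection ∘L A.sqrtResolvent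

theorem friedrichsShift_apply (y : H) : A.friedrichsShift ψ y =
    A.sqrtResolvent ((A.sqrtDefect ψ).starProjection (A.sqrtResolvent y)) := rfl

theorem friedrichsShift_mem (y : H) : A.friedrichsShift ψ y ∈ A.defectSpan ψ :=
  (A.mem_sqrtDefect ψ).mp (Submodule.starProjection_apply_mem _ _)

theorem friedrichsShift_eq_zero_iff {y : H} : A.friedrichsShift ψ y = 0 ↔
    y ∈ ((A.sqrtDefect ψ).map A.sqrtResolvent.toLinearMap)ᗮ := by
  rw [← sqrtResolvent_mem_orthogonal_sqrtDefect, friedrichsShift_apply,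
    ← Submodule.starProjection_apply_eq_zero_iff]
  exact ⟨fun h => A.sqrtResolvent_injective (h.trans (map_zero _).symm), fun h => by rw [h, map_zero]⟩

variable {ψ}

theorem defect'_eq (hN : ∀ y, A.resolvent y ∈ A.defectSpan ψ → y = 0) :
    A.defect' ψ = (A.sqrtDefect ψ).map A.sqrtResolvent.toLinearMap := by
  ext f
  rw [defect', A.defect_eq hN]
  constructor
  · rintro ⟨hf, q, rfl⟩
    exact ⟨q, hf, rfl⟩
  · rintro ⟨q, hq, rfl⟩
    exact ⟨hq, q, rfl⟩

theorem mem_defect'_iff (hN : ∀ y, A.resolvent y ∈ A.defectSpan ψ → y = 0) {g : H} :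
    g ∈ A.defect' ψ ↔ g ∈ A.defectSpan ψ ∧ g ∈ A.H1 := by
  rw [defect', A.defect_eq hN, Submodule.mem_inf]

/-- Write `f = B q`. Membership in the form domain means `q ⊥ Q`, and membership in the graph of the
adjoint means `q - B y ∈ Q`. So `q` is the component of `B y` orthogonal to `Q`. -/
theorem mem_graph_friedrichs (hN : ∀ y, A.resolvent y ∈ A.defectSpan ψ → y = 0) {f y : H} :
    (f, y - f) ∈ (friedrichs (A.symOp ψ)).graph ↔ f = A.resolvent y - A.friedrichsShift ψ y := by
  rw [friedrichs, mem_graph_domRestrict, A.mem_graph_adjoint_symOp hN, mem_formDomain_symOp]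
  constructor
  · rintro ⟨⟨q, hq, rfl⟩, h⟩
    rw [← sqrtResolvent_sqrtResolvent, ← map_sub, ← mem_sqrtDefect] at h
    have h1 := Submodule.starProjection_eq_self_iff.mpr h
    rw [map_sub, (Submodule.starProjection_apply_eq_zero_iff _).mpr hq, zero_sub] at h1
    rw [friedrichsShift_apply, ← sqrtResolvent_sqrtResolvent, ← map_sub]
    congr 1
    rw [sub_eq_add_neg, h1, add_sub_cancel]
  · rintro rfl
    refine ⟨⟨A.sqrtResolvent y - (A.sqrtDefect ψ).starProjection (A.sqrtResolvent y),
      Submodule.sub_starProjection_mem_orthogonal _, ?_⟩, ?_⟩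
    · rw [map_sub, sqrtResolvent_sqrtResolvent, friedrichsShift_apply]
    · rw [sub_sub_cancel_left]
      exact neg_mem (A.friedrichsShift_mem ψ y)

theorem mem_graph_intermediate (hN : ∀ y, A.resolvent y ∈ A.defectSpan ψ → y = 0)
    {K : Submodule ℂ H} {f y : H} : (f, y - f) ∈ (A.intermediate ψ K).graph ↔
      y ∈ (A.defectSpan ψ)ᗮ ⊔ K ∧ f = A.resolvent y - A.friedrichsShift ψ y := by
  rw [intermediate, mem_graph_domRestrict, mem_preimageAddOne_iff, ranAddOne_symOp,
    A.mem_graph_friedrichs hN]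
  constructor
  · rintro ⟨⟨z, hz, hf⟩, hy⟩
    have h := (A.mem_graph_friedrichs hN).mpr hy
    have := LinearPMap.mem_graph_snd_inj _ h hf rfl
    rw [sub_left_inj.mp this]
    exact ⟨hz, (A.mem_graph_friedrichs hN).mp hf⟩
  · rintro ⟨hy, hf⟩
    exact ⟨⟨y, hy, (A.mem_graph_friedrichs hN).mpr hf⟩, hf⟩

theorem inner_friedrichsShift {q : H} (hq : q ∈ A.sqrtDefect ψ) (y : H) :
    inner ℂ q ((A.sqrtDefect ψ).starProjection (A.sqrtResolvent y)) =
      inner ℂ (A.sqrtResolvent q) y := by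
  rw [← Submodule.inner_starProjection_left_eq_right, Submodule.starProjection_eq_self_iff.mpr hq,
    ← inner_sqrtResolvent]

/-- Defining equations of the extended functionals. -/
theorem mem_graph_extPairing (hN : ∀ y, A.resolvent y ∈ A.defectSpan ψ → y = 0)
    (hli : LinearIndependent ℂ (A.defectVec ψ)) (R : Matrix (Fin n) (Fin n) ℂ)
    {f : H} {b : Fin n → ℂ} :
    (f, b) ∈ (A.extPairing ψ R).graph ↔ ∃ (y : H) (α : Fin n → ℂ),
      A.resolvent y + ∑ p, α p • A.defectVec ψ p = f ∧
        ∀ j, inner ℂ (A.defectVec ψ j) y + ∑ p, R j p * α p = b j := by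
  have hrange : ∀ {f : H} {b : Fin n → ℂ},
      (f, b) ∈ LinearMap.range (A.extPairingGraphMap ψ R) ↔ ∃ (y : H) (α : Fin n → ℂ),
        A.resolvent y + ∑ p, α p • A.defectVec ψ p = f ∧
          ∀ j, inner ℂ (A.defectVec ψ j) y + ∑ p, R j p * α p = b j := by
    intro f b
    constructor
    · rintro ⟨⟨u, α⟩, h⟩
      rw [extPairingGraphMap_apply, Prod.mk.injEq] at h
      refine ⟨addOne A.toPMap u, α, ?_, fun j => congrFun h.2 j⟩
      rw [resolvent_addOne, h.1]
    · rintro ⟨y, α, h1, h2⟩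
      obtain ⟨u, rfl⟩ := A.addOne_surjective y
      refine ⟨⟨u, α⟩, ?_⟩
      rw [extPairingGraphMap_apply, Prod.mk.injEq, ← A.resolvent_addOne u]
      exact ⟨h1, funext h2⟩
  rw [extPairing, Submodule.toLinearPMap_graph_eq, hrange]
  rintro ⟨f, b⟩ hfb hf
  obtain ⟨y, α, h1, h2⟩ := hrange.mp hfb
  simp only at hf
  rw [hf] at h1
  -- The values are well defined: over `f = 0` the vector `(A + I)⁻¹ y` lies in `N`, which forces `y
  -- = 0`, then `α = 0`.
  have hy : y = 0 := by
    refine hN y ((A.mem_defectSpan_iff ψ).mpr ⟨-α, ?_⟩)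
    simp only [Pi.neg_apply, neg_smul, Finset.sum_neg_distrib]
    exact (eq_neg_of_add_eq_zero_left h1).symm
  subst hy
  rw [map_zero, zero_add] at h1
  have hα := Fintype.linearIndependent_iff.mp hli α h1
  funext j
  simp [← h2 j, hα]

end NonnegSelfAdjoint
end SingularPerturbation

/-! ### Extensions as subspaces of pairs `(y, g)` -/

namespace SingularPerturbation
namespace NonnegSelfAdjoint

variable {H : Type*} [NormedAddCommGroup H] [InnerProductSpace ℂ H] [CompleteSpace H]
  (A : NonnegSelfAdjoint H)

/-- The pairs `(y, g)` such that `f = (A + I)⁻¹ y + g` is in the domain of `T` and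
`(T + I) f = y`. -/
def defectPairs (T : H →ₗ.[ℂ] H) : Submodule ℂ (H × H) :=
  T.graph.comap
    ((A.resolvent.toLinearMap.coprod LinearMap.id).prod
      (LinearMap.fst ℂ H H - A.resolvent.toLinearMap.coprod LinearMap.id))

theorem mem_defectPairs {T : H →ₗ.[ℂ] H} {y g : H} : (y, g) ∈ A.defectPairs T ↔
    (A.resolvent y + g, y - (A.resolvent y + g)) ∈ T.graph := Iff.rfl

theorem mem_graph_iff_defectPairs {T : H →ₗ.[ℂ] H} {f w : H} :
    (f, w) ∈ T.graph ↔ (w + f, f - A.resolvent (w + f)) ∈ A.defectPairs T := by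
  rw [mem_defectPairs, add_sub_cancel, add_sub_cancel_right]

theorem defectPairs_mono {T U : H →ₗ.[ℂ] H} (h : T ≤ U) : A.defectPairs T ≤ A.defectPairs U :=
  Submodule.comap_mono (LinearPMap.le_graph_of_le h)

theorem eq_of_defectPairs_eq {T U : H →ₗ.[ℂ] H} (h : A.defectPairs T = A.defectPairs U) :
    T = U :=
  eq_of_mem_graph_iff fun f w => by
    rw [A.mem_graph_iff_defectPairs, h, ← A.mem_graph_iff_defectPairs]

/-- The terms `((A + I)⁻¹ y', y)` and `(y', (A + I)⁻¹ y)` agree and drop out of the adjoint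
relation. -/
theorem mem_defectPairs_adjoint {T : H →ₗ.[ℂ] H} (hT : Dense (T.domain : Set H)) {y g : H} :
    (y, g) ∈ A.defectPairs T.adjoint ↔
      ∀ y' g', (y', g') ∈ A.defectPairs T → inner ℂ g' y = inner ℂ y' g := by
  rw [mem_defectPairs, mem_graph_adjoint_iff hT]
  constructor
  · intro h y' g' h'
    have := h _ _ (A.mem_defectPairs.mp h')
    simp only [inner_sub_left, inner_sub_right, inner_add_left, inner_add_right,
      inner_resolvent] at this
    linear_combination -this
  · intro h a b hab
    have := h _ _ (A.mem_graph_iff_defectPairs.mp hab)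
    simp only [inner_sub_left, inner_sub_right, inner_add_left, inner_add_right, map_add,
      inner_resolvent] at this ⊢
    linear_combination -this

theorem mem_domain_of_mem_defectPairs {T : H →ₗ.[ℂ] H} {y g : H}
    (h : (y, g) ∈ A.defectPairs T) : A.resolvent y + g ∈ T.domain :=
  LinearPMap.mem_domain_of_mem_graph h

theorem exists_mem_defectPairs {T : H →ₗ.[ℂ] H} {f : H} (hf : f ∈ T.domain) :
    ∃ y g, (y, g) ∈ A.defectPairs T ∧ A.resolvent y + g = f := by
  obtain ⟨w, hw⟩ := LinearPMap.mem_domain_iff.mp hf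
  exact ⟨_, _, A.mem_graph_iff_defectPairs.mp hw, add_sub_cancel _ _⟩

variable {n : ℕ} {ψ : Fin n → A.HNegTwo}

theorem mem_defectPairs_symOp {y g : H} :
    (y, g) ∈ A.defectPairs (A.symOp ψ) ↔ g = 0 ∧ y ∈ (A.defectSpan ψ)ᗮ := by
  rw [mem_defectPairs, mem_graph_symOp, add_eq_left]

theorem mem_defectPairs_adjoint_symOp (hN : ∀ y, A.resolvent y ∈ A.defectSpan ψ → y = 0)
    {y g : H} : (y, g) ∈ A.defectPairs (A.symOp ψ).adjoint ↔ g ∈ A.defectSpan ψ := by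
  rw [mem_defectPairs, A.mem_graph_adjoint_symOp hN, add_sub_cancel_left]

theorem mem_defectPairs_friedrichs (hN : ∀ y, A.resolvent y ∈ A.defectSpan ψ → y = 0) {y g : H} :
    (y, g) ∈ A.defectPairs (friedrichs (A.symOp ψ)) ↔ g = -A.friedrichsShift ψ y := by
  rw [mem_defectPairs, A.mem_graph_friedrichs hN, sub_eq_add_neg, add_right_inj]

theorem mem_defectPairs_intermediate (hN : ∀ y, A.resolvent y ∈ A.defectSpan ψ → y = 0)
    {K : Submodule ℂ H} {y g : H} : (y, g) ∈ A.defectPairs (A.intermediate ψ K) ↔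
      y ∈ (A.defectSpan ψ)ᗮ ⊔ K ∧ g = -A.friedrichsShift ψ y := by
  rw [mem_defectPairs, A.mem_graph_intermediate hN, sub_eq_add_neg, add_right_inj]

theorem friedrichsShift_eq_zero_of_mem (hN : ∀ y, A.resolvent y ∈ A.defectSpan ψ → y = 0)
    {y : H} (hy : y ∈ (A.defectSpan ψ)ᗮ) : A.friedrichsShift ψ y = 0 := by
  rw [friedrichsShift_eq_zero_iff, ← A.defect'_eq hN]
  exact Submodule.orthogonal_le (fun g hg => ((A.mem_defect'_iff hN).mp hg).1) hy

theorem symOp_le_friedrichs (hN : ∀ y, A.resolvent y ∈ A.defectSpan ψ → y = 0) :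
    A.symOp ψ ≤ friedrichs (A.symOp ψ) := by
  refine LinearPMap.le_of_le_graph fun p hp => ?_
  obtain ⟨f, w⟩ := p
  rw [A.mem_graph_iff_defectPairs, mem_defectPairs_symOp] at hp
  rw [A.mem_graph_iff_defectPairs, A.mem_defectPairs_friedrichs hN,
    A.friedrichsShift_eq_zero_of_mem hN hp.2, neg_zero]
  exact hp.1

theorem friedrichsShift_mem_defect' (hN : ∀ y, A.resolvent y ∈ A.defectSpan ψ → y = 0) (y : H) :
    A.friedrichsShift ψ y ∈ A.defect' ψ :=
  (A.mem_defect'_iff hN).mpr ⟨A.friedrichsShift_mem ψ y, _, rfl⟩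

/-- The dimension and intersection conditions on `K`, expressed through the map
`(A + I)⁻¹ - (A_F + I)⁻¹`. -/
theorem finrank_eq_and_inf_eq_bot_iff (hN : ∀ y, A.resolvent y ∈ A.defectSpan ψ → y = 0)
    {K : Submodule ℂ H} (hK : K ≤ A.defectSpan ψ) :
    (Module.finrank ℂ K = Module.finrank ℂ (A.defect' ψ) ∧ K ⊓ A.defect'' ψ = ⊥) ↔
      (∀ k ∈ K, A.friedrichsShift ψ k = 0 → k = 0) ∧
        K.map (A.friedrichsShift ψ).toLinearMap = A.defect' ψ := by
  have hinf : K ⊓ A.defect'' ψ = ⊥ ↔ ∀ k ∈ K, A.friedrichsShift ψ k = 0 → k = 0 := by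
    rw [Submodule.eq_bot_iff]
    refine forall_congr' fun k => ?_
    rw [friedrichsShift_eq_zero_iff, ← A.defect'_eq hN, defect'', A.defect_eq hN]
    exact ⟨fun h hk hk' => h ⟨hk, hK hk, hk'⟩, fun h hk => h hk.1 hk.2.2⟩
  rw [hinf, and_comm]
  refine and_congr_right fun hinj => ?_
  have hfr : Module.finrank ℂ (K.map (A.friedrichsShift ψ).toLinearMap) = Module.finrank ℂ K := by
    rw [← LinearMap.range_domRestrict]
    refine LinearMap.finrank_range_of_inj ((injective_iff_map_eq_zero _).mpr fun k hk => ?_)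
    exact Subtype.ext (hinj k k.2 hk)
  have : FiniteDimensional ℂ (A.defect' ψ) :=
    Submodule.finiteDimensional_of_le (S₂ := A.defectSpan ψ)
      fun g hg => ((A.mem_defect'_iff hN).mp hg).1
  rw [← hfr]
  constructor
  · refine fun h => Submodule.eq_of_le_of_finrank_eq ?_ h
    rintro _ ⟨k, -, rfl⟩
    exact A.friedrichsShift_mem_defect' hN k
  · exact fun h => by rw [h]

theorem sum_mul_inner_defectVec (c : Fin n → ℂ) (y : H) :
    ∑ j, starRingEnd ℂ (c j) * inner ℂ (A.defectVec ψ j) y =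
      inner ℂ (∑ j, c j • A.defectVec ψ j) y := by
  simp only [sum_inner, inner_smul_left]

/-- The component of `f` in `D(A)` contributes equally to both sides of the admissibility identity,
so only `f ∈ 𝓗'` has to be tested. The condition prescribes the form of `R` on `𝓗'`. -/
theorem isAdmissibleMatrix_iff (hN : ∀ y, A.resolvent y ∈ A.defectSpan ψ → y = 0)
    (hli : LinearIndependent ℂ (A.defectVec ψ)) (R : Matrix (Fin n) (Fin n) ℂ) :
    A.IsAdmissibleMatrix ψ R ↔ R.IsHermitian ∧ ∀ (c α : Fin n → ℂ) (q r : H),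
      A.sqrtResolvent q = ∑ j, c j • A.defectVec ψ j →
      A.sqrtResolvent r = ∑ p, α p • A.defectVec ψ p →
        ∑ j, starRingEnd ℂ (c j) * ∑ p, R j p * α p = inner ℂ q r := by
  refine and_congr_right fun _ => ⟨fun h c α q r hq hr => ?_, fun h c _ f hf k _ hk => ?_⟩
  · have hg : (∑ p, α p • A.defectVec ψ p, fun j => ∑ p, R j p * α p) ∈
        (A.extPairing ψ R).graph :=
      (A.mem_graph_extPairing hN hli R).mpr ⟨0, α, by simp, by simp⟩
    obtain ⟨f, hf1, hf2⟩ := (LinearPMap.mem_graph_iff _).mp hg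
    simp only at hf1 hf2
    have hfH : (f : H) ∈ A.H1 := ⟨r, hr.trans hf1.symm⟩
    have hmem : (f : H) ∈ (A.symOp ψ).adjoint.domain := by
      have : ((0 : H), (f : H)) ∈ A.defectPairs (A.symOp ψ).adjoint := by
        rw [A.mem_defectPairs_adjoint_symOp hN, hf1, mem_defectSpan_iff]
        exact ⟨α, rfl⟩
      simpa using A.mem_domain_of_mem_defectPairs this
    have hqc : A.sqrtResolvent q = A.extResolvent (∑ j, c j • ψ j) :=
      hq.trans (A.extResolvent_sum ψ c).symm
    have := h c (A.mem_range_embedNegOne ⟨q, hqc⟩) f hfH ⟨_, q, hqc⟩ hmem rfl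
    rw [hf2, A.sqrtAddOne_eq (q := q) hqc, A.sqrtAddOne_eq (q := r) (hr.trans hf1.symm)] at this
    exact this
  · obtain ⟨y, α, h1, h2⟩ := (A.mem_graph_extPairing hN hli R).mp
      (LinearPMap.mem_graph _ f)
    obtain ⟨s, hs⟩ := id hf
    obtain ⟨q, hq⟩ := k.2
    -- Both `f = B s` and `(A + I)⁻¹ y = B (B y)` are in `H₁`, hence so is the remaining component
    -- of `f`.
    have hr : A.sqrtResolvent (s - A.sqrtResolvent y) = ∑ p, α p • A.defectVec ψ p := by
      rw [map_sub, sqrtResolvent_sqrtResolvent, sub_eq_iff_eq_add']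
      exact hs.trans h1.symm
    have hqc : A.sqrtResolvent q = ∑ j, c j • A.defectVec ψ j :=
      hq.trans (hk.trans (A.extResolvent_sum ψ c))
    rw [A.sqrtAddOne_eq (f := k) hq, A.sqrtAddOne_eq (f := ⟨f, hf⟩) hs]
    have := h c α q _ hqc hr
    simp only [← h2, mul_add, Finset.sum_add_distrib]
    rw [this, sum_mul_inner_defectVec, ← hqc, inner_sub_right, inner_sqrtResolvent]
    ring

/-- The restriction of `A_sym*` to the vectors on which the extended functionals vanish. -/
theorem mem_defectPairs_extPairing (hN : ∀ y, A.resolvent y ∈ A.defectSpan ψ → y = 0)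
    (hli : LinearIndependent ℂ (A.defectVec ψ)) (R : Matrix (Fin n) (Fin n) ℂ) {y g : H} :
    (y, g) ∈ A.defectPairs ((A.symOp ψ).adjoint.domRestrict
      ((LinearMap.ker (A.extPairing ψ R).toFun).map (A.extPairing ψ R).domain.subtype)) ↔
      ∃ α : Fin n → ℂ, ∑ p, α p • A.defectVec ψ p = g ∧
        ∀ j, inner ℂ (A.defectVec ψ j) y + ∑ p, R j p * α p = 0 := by
  have hker : ∀ f, f ∈ (LinearMap.ker (A.extPairing ψ R).toFun).map
      (A.extPairing ψ R).domain.subtype ↔ (f, 0) ∈ (A.extPairing ψ R).graph := fun f => by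
    rw [LinearPMap.mem_graph_iff]
    exact ⟨fun ⟨x, hx, hf⟩ => ⟨x, hf, hx⟩, fun ⟨x, hf, hx⟩ => ⟨x, hx, hf⟩⟩
  rw [mem_defectPairs, mem_graph_domRestrict, ← mem_defectPairs,
    A.mem_defectPairs_adjoint_symOp hN, hker, A.mem_graph_extPairing hN hli]
  constructor
  · rintro ⟨⟨z, α, h1, h2⟩, hg⟩
    have hzy : z - y = 0 := by
      refine hN _ ?_
      have : A.resolvent (z - y) = g - ∑ p, α p • A.defectVec ψ p := by
        rw [map_sub, sub_eq_sub_iff_add_eq_add, h1, add_comm]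
      rw [this]
      exact sub_mem hg ((A.mem_defectSpan_iff ψ).mpr ⟨α, rfl⟩)
    rw [sub_eq_zero] at hzy
    subst hzy
    exact ⟨α, add_left_cancel h1, h2⟩
  · rintro ⟨α, rfl, h⟩
    exact ⟨⟨y, α, rfl, h⟩, (A.mem_defectSpan_iff ψ).mpr ⟨α, rfl⟩⟩

/-- The Gram matrix of the `h_j` is injective, hence invertible, so `y` can be taken in their span.
-/
theorem exists_inner_defectVec_eq (hli : LinearIndependent ℂ (A.defectVec ψ)) (b : Fin n → ℂ) :
    ∃ y, ∀ j, inner ℂ (A.defectVec ψ j) y = b j := by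
  let L : H →ₗ[ℂ] (Fin n → ℂ) := LinearMap.pi fun j => innerₛₗ ℂ (A.defectVec ψ j)
  have hinj : Function.Injective (L ∘ₗ Fintype.linearCombination ℂ (A.defectVec ψ)) := by
    refine (injective_iff_map_eq_zero _).mpr fun β hβ => ?_
    have h1 : Fintype.linearCombination ℂ (A.defectVec ψ) β ∈ A.defectSpan ψ :=
      (A.mem_defectSpan_iff ψ).mpr ⟨β, rfl⟩
    have h2 : Fintype.linearCombination ℂ (A.defectVec ψ) β ∈ (A.defectSpan ψ)ᗮ :=
      (A.mem_orthogonal_defectSpan ψ).mpr fun j => congrFun hβ j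
    exact funext (Fintype.linearIndependent_iff.mp hli β
      (inner_self_eq_zero.mp (h2 _ h1)))
  obtain ⟨β, hβ⟩ := LinearMap.injective_iff_surjective.mp hinj b
  exact ⟨_, fun j => congrFun hβ j⟩

/-! ### Self-adjoint extensions and the two implications -/

section Extensions

variable {T S : H →ₗ.[ℂ] H} {K : Submodule ℂ H}

theorem le_adjoint_of_isSelfAdjoint (hN : ∀ y, A.resolvent y ∈ A.defectSpan ψ → y = 0)
    (hT : IsSelfAdjoint T) (hle : A.symOp ψ ≤ T) : T ≤ (A.symOp ψ).adjoint := by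
  have := adjoint_le_adjoint hle (A.dense_domain_symOp hN)
  rwa [LinearPMap.isSelfAdjoint_def.mp hT] at this

theorem mem_defectPairs_of_isSelfAdjoint (hT : IsSelfAdjoint T) {y g : H} :
    (y, g) ∈ A.defectPairs T ↔
      ∀ y' g', (y', g') ∈ A.defectPairs T → inner ℂ g' y = inner ℂ y' g := by
  rw [← A.mem_defectPairs_adjoint hT.dense_domain, LinearPMap.isSelfAdjoint_def.mp hT]

/-- If the vectors `g` occurring in the pairs `(y, g)` of a self-adjoint extension `T` exhaust
the span of the `h_j`, and those occurring in the pairs of `S ≤ T` exhaust the part of this span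
in `H₁`, then `T` is transversal to the Friedrichs extension of `S`. -/
theorem transversal_friedrichs (hN : ∀ y, A.resolvent y ∈ A.defectSpan ψ → y = 0)
    (hT : IsSelfAdjoint T) (hSsym : A.symOp ψ ≤ S) (hST : S ≤ T)
    (hTsurj : ∀ g ∈ A.defectSpan ψ, ∃ y, (y, g) ∈ A.defectPairs T)
    (hSsurj : ∀ g ∈ A.defect' ψ, ∃ y, (y, g) ∈ A.defectPairs S) :
    Transversal S T (friedrichs S) := by
  have hdS : Dense (S.domain : Set H) := (A.dense_domain_symOp hN).mono hSsym.1
  have hTS : T ≤ S.adjoint := by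
    have := adjoint_le_adjoint hST hdS
    rwa [LinearPMap.isSelfAdjoint_def.mp hT] at this
  refine le_antisymm (sup_le hTS.1 inf_le_right) fun f hf => ?_
  obtain ⟨y, g, hyg, rfl⟩ := A.exists_mem_defectPairs hf
  have hg : g ∈ A.defectSpan ψ := (A.mem_defectPairs_adjoint_symOp hN).mp
    (A.defectPairs_mono (adjoint_le_adjoint hSsym (A.dense_domain_symOp hN)) hyg)
  obtain ⟨z, hz⟩ := hTsurj g hg
  -- Subtracting a pair of `T` with the same `g` leaves `(A + I)⁻¹ (y - z)` in the domain of `S*`.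
  -- Pairing with `S` gives `y - z ⊥ 𝓗'`, which places this vector in the form domain of `A_sym`,
  -- hence in that of `S`.
  have hd : (y - z, 0) ∈ A.defectPairs S.adjoint := by
    have := sub_mem hyg (A.defectPairs_mono hTS hz)
    rwa [Prod.mk_sub_mk, sub_self] at this
  have horth : y - z ∈ (A.defect' ψ)ᗮ := fun g' hg' => by
    obtain ⟨y', hy'⟩ := hSsurj g' hg'
    rw [(A.mem_defectPairs_adjoint hdS).mp hd y' g' hy', inner_zero_right]
  rw [A.defect'_eq hN, ← sqrtResolvent_mem_orthogonal_sqrtDefect] at horth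
  have hdom : A.resolvent (y - z) ∈ (friedrichs S).domain := by
    refine ⟨formDomain_mono hSsym ((A.mem_formDomain_symOp ψ).mpr
      ⟨_, horth, A.sqrtResolvent_sqrtResolvent _⟩), ?_⟩
    simpa using A.mem_domain_of_mem_defectPairs hd
  refine Submodule.mem_sup.mpr ⟨_, A.mem_domain_of_mem_defectPairs hz, _, hdom, ?_⟩
  rw [map_sub]
  abel

/-- In the extension given by an admissible matrix, the pairs `(y, g)` with `g` in `H₁` belong to
the Friedrichs extension. -/
theorem eq_neg_friedrichsShift_of_admissible {R : Matrix (Fin n) (Fin n) ℂ}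
    (hR : ∀ (c α : Fin n → ℂ) (q r : H),
      A.sqrtResolvent q = ∑ j, c j • A.defectVec ψ j →
      A.sqrtResolvent r = ∑ p, α p • A.defectVec ψ p →
        ∑ j, starRingEnd ℂ (c j) * ∑ p, R j p * α p = inner ℂ q r)
    {y r : H} {α : Fin n → ℂ} (hr : A.sqrtResolvent r = ∑ p, α p • A.defectVec ψ p)
    (hy : ∀ j, inner ℂ (A.defectVec ψ j) y + ∑ p, R j p * α p = 0) :
    A.sqrtResolvent r = -A.friedrichsShift ψ y := by
  have hrQ : r ∈ A.sqrtDefect ψ := by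
    rw [mem_sqrtDefect, hr, mem_defectSpan_iff]
    exact ⟨α, rfl⟩
  -- The claim is `s = 0`. As `s ∈ Q`, expanding `B s = ∑ c_j h_j` turns `(s, s)` into the
  -- combination with coefficients `conj c_j` of the equations `hy`.
  set s := (A.sqrtDefect ψ).starProjection (A.sqrtResolvent y) + r with hs
  have hsQ : s ∈ A.sqrtDefect ψ := add_mem (Submodule.starProjection_apply_mem _ _) hrQ
  have hs0 : s = 0 := by
    rw [← inner_self_eq_zero (𝕜 := ℂ)]
    nth_rewrite 2 [hs]
    obtain ⟨c, hc⟩ := (A.mem_defectSpan_iff ψ).mp ((A.mem_sqrtDefect ψ).mp hsQ)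
    rw [inner_add_right, A.inner_friedrichsShift hsQ, ← hc, ← sum_mul_inner_defectVec,
      ← hR c α s r hc.symm hr, ← Finset.sum_add_distrib]
    exact Finset.sum_eq_zero fun j _ => by rw [← mul_add, hy, mul_zero]
  rw [friedrichsShift_apply, ← map_neg, ← eq_neg_of_add_eq_zero_right (hs.symm.trans hs0)]

theorem isAdmissible_iff (hN : ∀ y, A.resolvent y ∈ A.defectSpan ψ → y = 0)
    (hli : LinearIndependent ℂ (A.defectVec ψ)) : A.IsAdmissible ψ T ↔
      ∃ R : Matrix (Fin n) (Fin n) ℂ, A.IsAdmissibleMatrix ψ R ∧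
        ∀ y g, (y, g) ∈ A.defectPairs T ↔ ∃ α : Fin n → ℂ, ∑ p, α p • A.defectVec ψ p = g ∧
          ∀ j, inner ℂ (A.defectVec ψ j) y + ∑ p, R j p * α p = 0 := by
  refine exists_congr fun R => and_congr_right fun _ => ⟨?_, fun h => ?_⟩
  · rintro rfl y g
    exact A.mem_defectPairs_extPairing hN hli R
  · refine A.eq_of_defectPairs_eq (Submodule.ext fun p => ?_)
    obtain ⟨y, g⟩ := p
    rw [h, A.mem_defectPairs_extPairing hN hli]

/-- If `G k = 0`, then `(k, 0)` is a pair of `S ≤ T`, which forces `k ∈ N^⊥ ∩ N`. A pair of `T` with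
`g ∈ 𝓗'` is also a pair of `A_F`, thus of `S`; its `y` is in `N^⊥ + K`, and `G` vanishes on `N^⊥`.
-/
theorem friedrichsShift_bijective_of_isAdmissible
    (hN : ∀ y, A.resolvent y ∈ A.defectSpan ψ → y = 0)
    (hli : LinearIndependent ℂ (A.defectVec ψ)) (hK : K ≤ A.defectSpan ψ)
    (hS : S = T ⊓ friedrichs (A.symOp ψ)) (hSK : S = A.intermediate ψ K)
    (hadm : A.IsAdmissible ψ T) :
    (∀ g ∈ A.defectSpan ψ, ∃ y, (y, g) ∈ A.defectPairs T) ∧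
      (∀ k ∈ K, A.friedrichsShift ψ k = 0 → k = 0) ∧
        K.map (A.friedrichsShift ψ).toLinearMap = A.defect' ψ := by
  obtain ⟨R, hR, hTR⟩ := (A.isAdmissible_iff hN hli).mp hadm
  have hR := ((A.isAdmissibleMatrix_iff hN hli R).mp hR).2
  have hsurj : ∀ g ∈ A.defectSpan ψ, ∃ y, (y, g) ∈ A.defectPairs T := fun g hg => by
    obtain ⟨α, rfl⟩ := (A.mem_defectSpan_iff ψ).mp hg
    obtain ⟨y, hy⟩ := A.exists_inner_defectVec_eq hli fun j => -∑ p, R j p * α p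
    exact ⟨y, (hTR _ _).mpr ⟨α, rfl, fun j => by rw [hy, neg_add_cancel]⟩⟩
  refine ⟨hsurj, fun k hk hk0 => ?_, le_antisymm ?_ fun g hg => ?_⟩
  · have hkS : (k, 0) ∈ A.defectPairs S := by
      rw [hSK, A.mem_defectPairs_intermediate hN, hk0, neg_zero]
      exact ⟨Submodule.mem_sup_right hk, rfl⟩
    obtain ⟨α, hα, hj⟩ := (hTR _ _).mp (A.defectPairs_mono (hS ▸ inf_le_left) hkS)
    have hα0 := Fintype.linearIndependent_iff.mp hli α hα
    have hko : k ∈ (A.defectSpan ψ)ᗮ :=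
      (A.mem_orthogonal_defectSpan ψ).mpr fun j => by simpa [hα0] using hj j
    exact inner_self_eq_zero.mp (hko k (hK hk))
  · rintro _ ⟨k, -, rfl⟩
    exact A.friedrichsShift_mem_defect' hN k
  · obtain ⟨hgN, r, hr⟩ := (A.mem_defect'_iff hN).mp hg
    obtain ⟨y, hy⟩ := hsurj g hgN
    obtain ⟨α, hα, hj⟩ := (hTR _ _).mp hy
    have hr' : A.sqrtResolvent r = g := hr
    have hgy := A.eq_neg_friedrichsShift_of_admissible hR (hr'.trans hα.symm) hj
    rw [hr'] at hgy
    have hyS : (y, g) ∈ A.defectPairs S := by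
      rw [hS]
      exact mem_graph_inf.mpr ⟨hy, (A.mem_defectPairs_friedrichs hN).mpr hgy⟩
    rw [hSK, A.mem_defectPairs_intermediate hN] at hyS
    obtain ⟨m, hm, k, hk, rfl⟩ := Submodule.mem_sup.mp hyS.1
    refine ⟨-k, neg_mem hk, ?_⟩
    rw [hgy, map_add, A.friedrichsShift_eq_zero_of_mem hN hm, zero_add]
    exact map_neg _ k

theorem isAdmissible_of_friedrichsShift_bijective
    (hN : ∀ y, A.resolvent y ∈ A.defectSpan ψ → y = 0)
    (hli : LinearIndependent ℂ (A.defectVec ψ)) (hT : IsSelfAdjoint T) (hle : A.symOp ψ ≤ T)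
    (hS : S = T ⊓ friedrichs (A.symOp ψ)) (hSK : S = A.intermediate ψ K)
    (hinj : ∀ k ∈ K, A.friedrichsShift ψ k = 0 → k = 0)
    (hsurj : K.map (A.friedrichsShift ψ).toLinearMap = A.defect' ψ) :
    A.IsAdmissible ψ T := by
  have hST : A.defectPairs S ≤ A.defectPairs T := A.defectPairs_mono (hS ▸ inf_le_left)
  have hsymm := fun {y g : H} => (A.mem_defectPairs_of_isSelfAdjoint hT (y := y) (g := g)).mp
  have hS' : ∀ g ∈ A.defect' ψ, ∃ k, g = -A.friedrichsShift ψ k ∧ (k, g) ∈ A.defectPairs T := by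
    intro g hg
    obtain ⟨k, hk, hkg⟩ := hsurj.symm ▸ neg_mem hg
    have hkg' : g = -A.friedrichsShift ψ k := neg_eq_iff_eq_neg.mp hkg.symm
    refine ⟨k, hkg', hST ?_⟩
    rw [hSK, A.mem_defectPairs_intermediate hN]
    exact ⟨Submodule.mem_sup_right hk, hkg'⟩
  -- Symmetry against the pairs in `hS'` gives `y ⊥ 𝓗'`, so `G y = 0` and `(y, 0)` lies in both `T`
  -- and `A_F`, that is, in `S`. Injectivity of `G` on `K` then removes the `K`-component of `y`.
  have hmul : ∀ y, (y, 0) ∈ A.defectPairs T ↔ y ∈ (A.defectSpan ψ)ᗮ := by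
    refine fun y => ⟨fun hy => ?_, fun hy => A.defectPairs_mono hle
      (A.mem_defectPairs_symOp.mpr ⟨rfl, hy⟩)⟩
    have hy0 : A.friedrichsShift ψ y = 0 := by
      rw [friedrichsShift_eq_zero_iff, ← A.defect'_eq hN]
      intro g hg
      obtain ⟨k, -, hk⟩ := hS' g hg
      rw [hsymm hy k g hk, inner_zero_right]
    have hyS : (y, 0) ∈ A.defectPairs S := by
      rw [hS]
      exact mem_graph_inf.mpr ⟨hy, (A.mem_defectPairs_friedrichs hN).mpr (by rw [hy0, neg_zero])⟩
    rw [hSK, A.mem_defectPairs_intermediate hN] at hyS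
    obtain ⟨m, hm, k, hk, rfl⟩ := Submodule.mem_sup.mp hyS.1
    rw [map_add, A.friedrichsShift_eq_zero_of_mem hN hm, zero_add] at hy0
    rwa [hinj k hk hy0, add_zero]
  have hTN : ∀ {y g}, (y, g) ∈ A.defectPairs T → g ∈ A.defectSpan ψ := fun h =>
    (A.mem_defectPairs_adjoint_symOp hN).mp
      (A.defectPairs_mono (A.le_adjoint_of_isSelfAdjoint hN hT hle) h)
  have hdom : (A.defectPairs T).map (LinearMap.snd ℂ H H) = A.defectSpan ψ := by
    have hle' : (A.defectPairs T).map (LinearMap.snd ℂ H H) ≤ A.defectSpan ψ := by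
      rintro _ ⟨⟨y, g⟩, h, rfl⟩
      exact hTN h
    have : FiniteDimensional ℂ ((A.defectPairs T).map (LinearMap.snd ℂ H H)) :=
      Submodule.finiteDimensional_of_le hle'
    -- A vector `k` orthogonal to all second components satisfies the adjoint relation as `(k, 0)`,
    -- so it is a pair of `T = T*`, and `hmul` gives `k ∈ N^⊥`.
    have hbot : ((A.defectPairs T).map (LinearMap.snd ℂ H H))ᗮ ⊓ A.defectSpan ψ = ⊥ := by
      rw [Submodule.eq_bot_iff]
      rintro k ⟨hk, hkN⟩
      have hk0 : (k, 0) ∈ A.defectPairs T :=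
        (A.mem_defectPairs_of_isSelfAdjoint hT).mpr fun y' g' h => by
          rw [inner_zero_right]
          exact hk g' ⟨(y', g'), h, rfl⟩
      exact inner_self_eq_zero.mp ((hmul k).mp hk0 k hkN)
    rw [← Submodule.sup_orthogonal_inf_of_hasOrthogonalProjection hle', hbot, sup_bot_eq]
  have hex : ∀ p, ∃ y, (y, A.defectVec ψ p) ∈ A.defectPairs T := fun p => by
    obtain ⟨⟨y, g⟩, h, hg⟩ := hdom.symm ▸ A.defectVec_mem ψ p
    exact ⟨y, hg ▸ h⟩
  choose y hy using hex
  have hcomb : ∀ α : Fin n → ℂ,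
      (∑ p, α p • y p, ∑ p, α p • A.defectVec ψ p) ∈ A.defectPairs T := fun α => by
    have := Submodule.sum_mem _ fun p (_ : p ∈ Finset.univ) =>
      Submodule.smul_mem _ (α p) (hy p)
    have he : (∑ p, α p • y p, ∑ p, α p • A.defectVec ψ p) =
        ∑ p, α p • (y p, A.defectVec ψ p) :=
      Prod.ext (by simp [Prod.fst_sum]) (by simp [Prod.snd_sum])
    rwa [he]
  have hsum : ∀ (α : Fin n → ℂ) j, ∑ p, -inner ℂ (A.defectVec ψ j) (y p) * α p =
      -inner ℂ (A.defectVec ψ j) (∑ p, α p • y p) := fun α j => by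
    rw [inner_sum, ← Finset.sum_neg_distrib]
    exact Finset.sum_congr rfl fun p _ => by rw [inner_smul_right]; ring
  -- The entries `r_jp = -(h_j, y_p)` are forced by the equations `(h_j, y_p) + r_jp = 0` for the
  -- pair `(y_p, h_p)`. The pairing symmetry of `T` makes `R` Hermitian.
  refine (A.isAdmissible_iff hN hli).mpr
    ⟨Matrix.of fun j p => -inner ℂ (A.defectVec ψ j) (y p),
      (A.isAdmissibleMatrix_iff hN hli _).mpr ⟨?_, fun c α q r hq hr => ?_⟩, fun z g => ?_⟩
  · ext j p
    simp only [Matrix.conjTranspose_apply, Matrix.of_apply, star_neg, neg_inj]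
    rw [← starRingEnd_apply, inner_conj_symm]
    exact (hsymm (hy p) _ _ (hy j)).symm
  · simp only [Matrix.of_apply, hsum, mul_neg, Finset.sum_neg_distrib]
    rw [sum_mul_inner_defectVec, ← hq]
    have hq' : A.sqrtResolvent q ∈ A.defect' ψ :=
      (A.mem_defect'_iff hN).mpr ⟨(A.mem_defectSpan_iff ψ).mpr ⟨c, hq.symm⟩, q, rfl⟩
    have hr' : A.sqrtResolvent r ∈ A.defect' ψ :=
      (A.mem_defect'_iff hN).mpr ⟨(A.mem_defectSpan_iff ψ).mpr ⟨α, hr.symm⟩, r, rfl⟩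
    -- The vector `∑ α_p y_p` may be replaced by `k`, since both are paired with `B r` and so differ
    -- by an element of `N^⊥`. For `k`, the relation `B r = -G k` reads `r = -Π B k`, and the
    -- identity follows.
    obtain ⟨k, hk, hkT⟩ := hS' _ hr'
    have hd := sub_mem (hcomb α) hkT
    rw [Prod.mk_sub_mk, hr, sub_self, hmul] at hd
    have h1 := hd _ ((A.mem_defect'_iff hN).mp hq').1
    rw [inner_sub_right, sub_eq_zero] at h1
    rw [friedrichsShift_apply, ← map_neg] at hk
    rw [h1, A.sqrtResolvent_injective hk, inner_neg_right,
      A.inner_friedrichsShift ((A.mem_defect'_iff hN).mp hq').1]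
  · simp only [Matrix.of_apply, hsum, ← sub_eq_add_neg, ← inner_sub_right]
    -- Subtracting the known pair with the same second component reduces membership to `hmul`.
    have hdiff : ∀ α : Fin n → ℂ, (z, ∑ p, α p • A.defectVec ψ p) ∈ A.defectPairs T ↔
        ∀ j, inner ℂ (A.defectVec ψ j) (z - ∑ p, α p • y p) = 0 := fun α => by
      rw [← mem_orthogonal_defectSpan, ← hmul, ← Submodule.sub_mem_iff_left _ (hcomb α),
        Prod.mk_sub_mk, sub_self]
    constructor
    · intro h
      obtain ⟨α, rfl⟩ := (A.mem_defectSpan_iff ψ).mp (hTN h)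
      exact ⟨α, rfl, (hdiff α).mp h⟩
    · rintro ⟨α, rfl, h⟩
      exact (hdiff α).mpr h

end Extensions

end NonnegSelfAdjoint
end SingularPerturbation

end

theorem mainTheorem2 {H : Type*} [NormedAddCommGroup H] [InnerProductSpace ℂ H] [CompleteSpace H]
    (A₀ : SingularPerturbation.NonnegSelfAdjoint H) {n : ℕ} (ψ : Fin n → A₀.HNegTwo)
    (hψ : LinearIndependent ℂ ψ)
    (hψH : Submodule.span ℂ (Set.range ψ) ⊓ LinearMap.range A₀.embed = ⊥)
    (Atilde : H →ₗ.[ℂ] H) (hsa : IsSelfAdjoint Atilde) (hext : A₀.symOp ψ ≤ Atilde)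
    (S : H →ₗ.[ℂ] H) (hS : S = Atilde ⊓ SingularPerturbation.friedrichs (A₀.symOp ψ))
    (Htilde : Submodule ℂ H) (hH : Htilde ≤ A₀.defect ψ)
    (hSH : S = A₀.intermediate ψ Htilde) :
    A₀.IsAdmissible ψ Atilde ↔
      (S ≤ Atilde ∧ IsSelfAdjoint Atilde ∧
        SingularPerturbation.Transversal S Atilde (SingularPerturbation.friedrichs S)) ∧
      Module.finrank ℂ Htilde = Module.finrank ℂ (A₀.defect' ψ) ∧
      Htilde ⊓ A₀.defect'' ψ = ⊥ := by
  have hN := A₀.eq_zero_of_resolvent_mem_defectSpan ψ hψH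
  have hli := A₀.linearIndependent_defectVec ψ hψ
  rw [A₀.defect_eq hN] at hH
  have hST : S ≤ Atilde := hS ▸ inf_le_left
  rw [A₀.finrank_eq_and_inf_eq_bot_iff hN hH]
  constructor
  · intro h
    obtain ⟨hdom, hinj, hsurj⟩ :=
      A₀.friedrichsShift_bijective_of_isAdmissible hN hli hH hS hSH h
    refine ⟨⟨hST, hsa, A₀.transversal_friedrichs hN hsa ?_ hST hdom fun g hg => ?_⟩, hinj, hsurj⟩
    · rw [hS]
      exact le_inf hext (A₀.symOp_le_friedrichs hN)
    · obtain ⟨k, hk, hkg⟩ := hsurj.symm ▸ neg_mem hg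
      refine ⟨k, ?_⟩
      rw [hSH, A₀.mem_defectPairs_intermediate hN]
      exact ⟨Submodule.mem_sup_right hk, neg_eq_iff_eq_neg.mp hkg.symm⟩
  · exact fun h => A₀.isAdmissible_of_friedrichsShift_bijective hN hli hsa hext hS hSH h.2.1 h.2.2
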